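/- Let $N\ge 3$, $n\ge 2$, let $\Omega\subset\mathbb R^N$ be an open set and let $a_1,\dots,a_n\in\Omega$ be pairwise distinct points. Put $$V(x)=\sum_{1\le i<j\le n}\frac{|a_i-a_j|^2}{|x-a_i|^2\,|x-a_j|^2},\qquad \mu^\star(\Omega)=\inf_{u\in D^{1,2}_0(\Omega),\ u\ne 0}\ \frac{\int_\Omega|\nabla u|^2\,dx}{\int_\Omega V u^2\,dx},$$ where $D^{1,2}_0(\Omega)$ is the completion of $C_c^\infty(\Omega)$ with respect to the norm $\left(\int_\Omega|\nabla u|^2\,dx\right)^{1/2}$ (a space of functions in $L^{2N/(N-2)}(\Omega)$ with weak gradient in $L^2(\Omega)$; it equals $H^1_0(\Omega)$ if $\Omega$ is bounded). (i) If $n=2$, then $\mu^\star(\Omega)=\dfrac{(N-2)^2}{4}$, whether $\Omega$ is bounded or not. (ii) If $n\ge 3$ and $\Omega$ is bounded, then $$\frac{(N-2)^2}{n^2}<\mu^\star(\Omega)\le\frac{(N-2)^2}{4n-4}.$$ -/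

import Mathlib

open MeasureTheory Filter Topology TopologicalSpace
open scoped ENNReal Distributions

noncomputable section

namespace MultipolarHardy

/-- The multi-singular potential
`V(x) = ∑_{i < j} |a_i - a_j|² / (|x - a_i|² |x - a_j|²)`. -/
def potential {N n : ℕ} (a : Fin n → EuclideanSpace ℝ (Fin N))
    (x : EuclideanSpace ℝ (Fin N)) : ℝ :=
  ∑ i, ∑ j ∈ Finset.Ioi i, ‖a i - a j‖ ^ 2 / (‖x - a i‖ ^ 2 * ‖x - a j‖ ^ 2)

/-- `G` is the weak gradient of `u` on the open set `Ω`: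
`∫_Ω u ∂_v ψ = - ∫_Ω ⟨G, v⟩ ψ` for all `ψ ∈ C_c^∞(Ω)` and all directions `v`. -/
def HasWeakGradient {N : ℕ} (Ω : Opens (EuclideanSpace ℝ (Fin N)))
    (u : EuclideanSpace ℝ (Fin N) → ℝ)
    (G : EuclideanSpace ℝ (Fin N) → EuclideanSpace ℝ (Fin N)) : Prop :=
  ∀ (ψ : 𝓓(Ω, ℝ)) (v : EuclideanSpace ℝ (Fin N)),
    ∫ x in Ω, u x * fderiv ℝ ψ x v = - ∫ x in Ω, inner ℝ (G x) v * ψ x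

/-- The critical Sobolev exponent `2* = 2N / (N - 2)` (used for `N ≥ 3`). -/
def sobolevExponent (N : ℕ) : ℝ≥0∞ :=
  ENNReal.ofReal (2 * (N : ℝ) / ((N : ℝ) - 2))

/-- For `N ≥ 3`, `MemD12 Ω u G` says that `u` belongs to `D^{1,2}_0(Ω)`, the completion of
`C_c^∞(Ω)` with respect to the Dirichlet norm `‖∇φ‖_{L²(Ω)}`, and that `G` is its weak gradient.

By the Sobolev inequality a sequence in `C_c^∞(Ω)` that is Cauchy for the Dirichlet norm
converges in `L^{2*}(Ω)`, which identifies the completion with the set of those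
`u ∈ L^{2*}(Ω)` for which there are `φ_k ∈ C_c^∞(Ω)` with `∇φ_k → ∇u` in `L²(Ω)` and
`φ_k → u` in `L^{2*}(Ω)`. Only the values on `Ω` matter. -/
structure MemD12 {N : ℕ} (Ω : Opens (EuclideanSpace ℝ (Fin N)))
    (u : EuclideanSpace ℝ (Fin N) → ℝ)
    (G : EuclideanSpace ℝ (Fin N) → EuclideanSpace ℝ (Fin N)) : Prop where
  memLp : MemLp u (sobolevExponent N) (volume.restrict Ω)
  memLp_grad : MemLp G 2 (volume.restrict Ω)
  weakGradient : HasWeakGradient Ω u G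
  approx : ∃ φ : ℕ → 𝓓(Ω, ℝ),
    Tendsto (fun k => eLpNorm (fun x => φ k x - u x) (sobolevExponent N) (volume.restrict Ω))
      atTop (𝓝 0) ∧
    Tendsto (fun k => eLpNorm (fun x => gradient (φ k) x - G x) 2 (volume.restrict Ω))
      atTop (𝓝 0)

/-- The Hardy constant: the infimum of `∫_Ω |∇u|² / ∫_Ω V u²` over all nonzero
`u ∈ D^{1,2}_0(Ω)`, an element of `[0, ∞]`. Both integrals are Lebesgue integrals of nonnegative
functions, so that no integrability of `V u²` is presupposed (the quotient of a finite number
by `∞` is `0`). -/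
def hardyConstant {N n : ℕ} (Ω : Opens (EuclideanSpace ℝ (Fin N)))
    (a : Fin n → EuclideanSpace ℝ (Fin N)) : ℝ≥0∞ :=
  sInf {q : ℝ≥0∞ | ∃ (u : EuclideanSpace ℝ (Fin N) → ℝ)
      (G : EuclideanSpace ℝ (Fin N) → EuclideanSpace ℝ (Fin N)),
    MemD12 Ω u G ∧ ¬ (u =ᵐ[volume.restrict Ω] 0) ∧
    q = (∫⁻ x in Ω, ENNReal.ofReal (‖G x‖ ^ 2)) /
        (∫⁻ x in Ω, ENNReal.ofReal (potential a x * u x ^ 2))}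

end MultipolarHardy

end

/-! Write w_i = (x - a_i)/|x - a_i|², W = ∑ w_i, S = ∑ |w_i|² and β = (N-2)/n. Inversion distances
give |w_i - w_j| = |a_i - a_j|/(|x - a_i||x - a_j|), so Lagrange's identity yields V = nS - |W|²
(`potential_eq`). Lower bounds: for a vector field G, expanding |∇φ + φG|² ≥ 0 gives ∫ φ²(div G -
|G|²) ≤ ∫ |∇φ|². For G = αW the density is α(N-2)S - α²|W|² = αβV + α(β-α)|W|². Taking α = β gives
the constant β² for every n. Strictness for n ≥ 3: taking α = 3β/2 gains β²V/2 and loses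
(3/4)β²|W|². Near a pole |W|² ~ r⁻² while V ~ (n-1)r⁻², so the gain wins there; elsewhere on the
closure of Ω, the loss is at most a multiple of Φ = ∏ |x - a_i|^(2β). The field βW + tΦx supplies
such a term: its density is β²V + tNΦ - t²Φ²|x|², and tΦ|x|² ≤ 1 on bounded Ω for small t. A
weighted average of the two inequalities beats β² (`lt_hardyConstant`). Upper bound: near a pole V ≥
(n-1-δ)r⁻², so truncations of (r² + ε)^(-(N-2)/4) concentrate there with quotients whose upper limit
is at most ((N-2)²/4)/(n-1-δ) (`hardyConstant_le`). For n = 2 the two bounds coincide. -/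

noncomputable section

namespace MultipolarHardy

/-! ### Hardy inequalities from vector fields -/

section VectorFields

variable {E : Type*} [NormedAddCommGroup E] [InnerProductSpace ℝ E] [FiniteDimensional ℝ E]
  [MeasurableSpace E] [BorelSpace E]

/-- The divergence theorem for the compactly supported field `g(x) (x - b)`. -/
theorem integral_finrank_mul_add_fderiv_sub_eq_zero {g : E → ℝ} (hg : ContDiff ℝ 1 g)
    (hgs : HasCompactSupport g) (b : E) :
    ∫ x, ((Module.finrank ℝ E : ℝ) * g x + fderiv ℝ g x (x - b)) = 0 := by
  set B := stdOrthonormalBasis ℝ E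
  have hDc : Continuous (fderiv ℝ g) := hg.continuous_fderiv one_ne_zero
  have hDs : HasCompactSupport (fderiv ℝ g) := hgs.fderiv ℝ
  have hgi : Integrable g := hg.continuous.integrable_of_hasCompactSupport hgs
  have hterm : ∀ i, Integrable (fun x => inner ℝ (B i) (x - b) * fderiv ℝ g x (B i)) := by
    intro i
    refine Continuous.integrable_of_hasCompactSupport (by fun_prop) ?_
    refine hDs.mono' fun x hx => subset_tsupport _ ?_
    contrapose! hx
    simp [Function.notMem_support.mp hx]
  -- Each coordinate contributes -∫ g after integration by parts; the `finrank` of them cancel the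
  -- first term.
  have hparts : ∀ i, ∫ x, inner ℝ (B i) (x - b) * fderiv ℝ g x (B i) = -∫ x, g x := by
    intro i
    have hder : ∀ x : E, fderiv ℝ (fun x : E => inner ℝ (B i) (x - b)) x (B i) = 1 := by
      intro x
      have h1 : HasFDerivAt (fun x : E => inner ℝ (B i) (x - b)) (innerSL ℝ (B i)) x := by
        have := (innerSL ℝ (B i)).hasFDerivAt.comp x ((hasFDerivAt_id x).sub_const b)
        simpa [Function.comp_def] using this
      rw [h1.fderiv]
      simp [B.orthonormal.1 i]
    rw [integral_mul_fderiv_eq_neg_fderiv_mul_of_integrable]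
    · simp [hder]
    · simpa [hder] using hgi
    · exact hterm i
    · refine Continuous.integrable_of_hasCompactSupport
        (Continuous.mul (by fun_prop) hg.continuous) hgs.mul_left
    · intro x _
      exact (differentiableAt_const _).inner ℝ (differentiableAt_id.sub_const b)
    · intro x _; exact hg.differentiable one_ne_zero x
  have hsum : ∀ x, (Module.finrank ℝ E : ℝ) * g x + fderiv ℝ g x (x - b)
      = (Module.finrank ℝ E : ℝ) * g x
        + ∑ i, inner ℝ (B i) (x - b) * fderiv ℝ g x (B i) := by
    intro x
    congr 1
    conv_lhs => rw [← B.sum_repr' (x - b)]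
    simp
  simp_rw [hsum]
  rw [integral_add (hgi.const_mul _) (integrable_finsetSum _ fun i _ => hterm i),
    integral_finsetSum _ fun i _ => hterm i, integral_const_mul]
  simp [hparts]

/-- Hardy-type inequality attached to the vector field `∑ i, g i x • (x - b i)`. -/
theorem integral_sq_mul_div_sub_norm_sq_le {ι : Type*} [Fintype ι] {φ : E → ℝ}
    (hφ : ContDiff ℝ 1 φ) (hφs : HasCompactSupport φ) {g : ι → E → ℝ}
    (hg : ∀ i, ContDiff ℝ 1 (g i)) (b : ι → E) :
    ∫ x, φ x ^ 2 * (∑ i, ((Module.finrank ℝ E : ℝ) * g i x + fderiv ℝ (g i) x (x - b i))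
        - ‖∑ i, g i x • (x - b i)‖ ^ 2) ≤ ∫ x, ‖gradient φ x‖ ^ 2 := by
  have hφc := hφ.continuous
  have hDφ : Continuous (fderiv ℝ φ) := hφ.continuous_fderiv one_ne_zero
  have hgc := fun i => (hg i).continuous
  have hDg : ∀ i, Continuous (fderiv ℝ (g i)) := fun i => (hg i).continuous_fderiv one_ne_zero
  have hgrad : Continuous (gradient φ) :=
    (InnerProductSpace.toDual ℝ E).symm.continuous.comp hDφ
  have hgrads : HasCompactSupport (gradient φ) :=
    (hφs.fderiv ℝ).comp_left (map_zero (InnerProductSpace.toDual ℝ E).symm)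
  have hprod : ∀ i x, fderiv ℝ (fun y => g i y * φ y ^ 2) x (x - b i)
      = φ x ^ 2 * fderiv ℝ (g i) x (x - b i) + 2 * φ x * inner ℝ (gradient φ x) (g i x • (x - b i)) := by
    intro i x
    have h1 : HasFDerivAt (fun y => g i y * φ y ^ 2) _ x := ((hg i).differentiable one_ne_zero x).hasFDerivAt.mul
      ((hφ.differentiable one_ne_zero x).hasFDerivAt.pow 2)
    have h2 : inner ℝ (gradient φ x) (x - b i) = fderiv ℝ φ x (x - b i) := by
      simp [gradient]
    rw [h1.fderiv, inner_smul_right, h2]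
    simp
    ring
  have hsmooth : ∀ i, ContDiff ℝ 1 (fun y => g i y * φ y ^ 2) := fun i => (hg i).mul (hφ.pow 2)
  have hφ2s : HasCompactSupport fun y => φ y ^ 2 := by
    simpa [Function.comp_def] using hφs.comp_left (g := fun t : ℝ => t ^ 2) (by simp)
  have hzero : ∀ i, ∫ x, ((Module.finrank ℝ E : ℝ) * (g i x * φ x ^ 2)
      + (φ x ^ 2 * fderiv ℝ (g i) x (x - b i)
        + 2 * φ x * inner ℝ (gradient φ x) (g i x • (x - b i)))) = 0 := by
    intro i
    rw [← integral_finrank_mul_add_fderiv_sub_eq_zero (hsmooth i) hφ2s.mul_left (b i)]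
    simp_rw [hprod]
  have hint : ∀ i, Integrable fun x => ((Module.finrank ℝ E : ℝ) * (g i x * φ x ^ 2)
      + (φ x ^ 2 * fderiv ℝ (g i) x (x - b i)
        + 2 * φ x * inner ℝ (gradient φ x) (g i x • (x - b i)))) := by
    intro i
    refine Continuous.integrable_of_hasCompactSupport ?_ ?_
    · have := hgc i
      have := hDg i
      fun_prop
    · refine hφs.mono' fun x hx => subset_tsupport _ ?_
      contrapose! hx
      simp [Function.notMem_support.mp hx]
  have hint1 : Integrable fun x => φ x ^ 2 * (∑ i, ((Module.finrank ℝ E : ℝ) * g i x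
      + fderiv ℝ (g i) x (x - b i)) - ‖∑ i, g i x • (x - b i)‖ ^ 2) := by
    refine Continuous.integrable_of_hasCompactSupport ?_ hφ2s.mul_right
    fun_prop
  have hint2 : Integrable fun x => ‖gradient φ x‖ ^ 2 :=
    Continuous.integrable_of_hasCompactSupport (by fun_prop)
      (hgrads.comp_left (g := fun v => ‖v‖ ^ 2) (by simp))
  have hS : ∫ x, ∑ i, ((Module.finrank ℝ E : ℝ) * (g i x * φ x ^ 2)
      + (φ x ^ 2 * fderiv ℝ (g i) x (x - b i)
        + 2 * φ x * inner ℝ (gradient φ x) (g i x • (x - b i)))) = 0 := by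
    rw [integral_finsetSum _ fun i _ => hint i]
    exact Finset.sum_eq_zero fun i _ => hzero i
  have hintS := integrable_finsetSum Finset.univ fun i _ => hint i
  -- Subtracting ∫ div(φ²G) = 0 makes the inequality pointwise: it becomes |∇φ + φG|² ≥ 0.
  rw [← sub_zero (∫ x, φ x ^ 2 * _), ← hS, ← integral_sub hint1 hintS]
  refine integral_mono (hint1.sub hintS) hint2 fun x => ?_
  have hsq : 0 ≤ ‖gradient φ x + φ x • ∑ i, g i x • (x - b i)‖ ^ 2 := by positivity
  rw [norm_add_sq_real, inner_smul_right, norm_smul, mul_pow, Real.norm_eq_abs, sq_abs] at hsq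
  have hexp : ∑ i, ((Module.finrank ℝ E : ℝ) * (g i x * φ x ^ 2)
      + (φ x ^ 2 * fderiv ℝ (g i) x (x - b i)
        + 2 * φ x * inner ℝ (gradient φ x) (g i x • (x - b i))))
      = φ x ^ 2 * ∑ i, ((Module.finrank ℝ E : ℝ) * g i x + fderiv ℝ (g i) x (x - b i))
        + 2 * (φ x * inner ℝ (gradient φ x) (∑ i, g i x • (x - b i))) := by
    rw [inner_sum, Finset.mul_sum, Finset.mul_sum, Finset.mul_sum, ← Finset.sum_add_distrib]
    refine Finset.sum_congr rfl fun i _ => ?_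
    ring
  simp only
  rw [hexp]
  linarith

end VectorFields

/-! ### Smooth fields with the poles regularized by ε -/

section Regularization

variable {E : Type*} [NormedAddCommGroup E] [InnerProductSpace ℝ E]
  {ι : Type*} [Fintype ι]

/-- The field `∑ i, (x - a i) / (|x - a i|² + ε)`. -/
def poleField (a : ι → E) (ε : ℝ) (x : E) : E := ∑ i, (‖x - a i‖ ^ 2 + ε)⁻¹ • (x - a i)

/-- The weight `∏ i, (|x - a i|² + ε) ^ α`. -/
def poleWeight (a : ι → E) (α ε : ℝ) (x : E) : ℝ := ∏ i, (‖x - a i‖ ^ 2 + ε) ^ α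

/-- `div G - |G|²` for the vector field `G(x) = α • poleField a ε x + t poleWeight a α ε x • x`
on an `N`-dimensional space. -/
def poleDensity (a : ι → E) (N α t ε : ℝ) (x : E) : ℝ :=
  α * ∑ i, (N * (‖x - a i‖ ^ 2 + ε)⁻¹ - 2 * ‖x - a i‖ ^ 2 * ((‖x - a i‖ ^ 2 + ε) ^ 2)⁻¹)
    - α ^ 2 * ‖poleField a ε x‖ ^ 2
    + (t * N * poleWeight a α ε x - t ^ 2 * (poleWeight a α ε x ^ 2 * ‖x‖ ^ 2))

theorem hasFDerivAt_norm_sub_sq_add (a : E) (ε : ℝ) (x : E) :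
    HasFDerivAt (fun y => ‖y - a‖ ^ 2 + ε) (2 • innerSL ℝ (x - a)) x := by
  have h := (hasStrictFDerivAt_norm_sq (x - a)).hasFDerivAt.comp x
    ((hasFDerivAt_id x).sub_const a)
  simpa [Function.comp_def] using h.add_const ε

theorem contDiff_norm_sub_sq_add (a : E) (ε : ℝ) {m : WithTop ℕ∞} :
    ContDiff ℝ m (fun y : E => ‖y - a‖ ^ 2 + ε) :=
  ((contDiff_id.sub contDiff_const).norm_sq ℝ).add contDiff_const

theorem contDiff_inv_norm_sub_sq_add (a : E) {ε : ℝ} (hε : 0 < ε) {m : WithTop ℕ∞} :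
    ContDiff ℝ m (fun y : E => (‖y - a‖ ^ 2 + ε)⁻¹) :=
  (contDiff_norm_sub_sq_add a ε).inv fun y => by positivity

theorem fderiv_inv_norm_sub_sq_add_apply (a : E) {ε : ℝ} (hε : 0 < ε) (x : E) :
    fderiv ℝ (fun y : E => (‖y - a‖ ^ 2 + ε)⁻¹) x (x - a)
      = -(2 * ‖x - a‖ ^ 2 * ((‖x - a‖ ^ 2 + ε) ^ 2)⁻¹) := by
  have hne : ‖x - a‖ ^ 2 + ε ≠ 0 := by positivity
  have h := (hasDerivAt_inv hne).comp_hasFDerivAt x (hasFDerivAt_norm_sub_sq_add a ε x)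
  rw [show (fun y : E => (‖y - a‖ ^ 2 + ε)⁻¹) = Inv.inv ∘ fun y => ‖y - a‖ ^ 2 + ε from rfl,
    h.fderiv]
  simp only [smul_apply, innerSL_apply_apply, real_inner_self_eq_norm_sq,
    smul_eq_mul, nsmul_eq_mul]
  push_cast
  ring

theorem contDiff_poleWeight (a : ι → E) (α : ℝ) {ε : ℝ} (hε : 0 < ε) {m : WithTop ℕ∞} :
    ContDiff ℝ m (poleWeight a α ε) :=
  contDiff_prod fun i _ => (contDiff_norm_sub_sq_add (a i) ε).rpow_const_of_ne
    fun y => by positivity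

theorem fderiv_poleWeight_apply (a : ι → E) (α : ℝ) {ε : ℝ} (hε : 0 < ε) (x v : E) :
    fderiv ℝ (poleWeight a α ε) x v
      = 2 * α * poleWeight a α ε x * inner ℝ (poleField a ε x) v := by
  -- The logarithmic form turns the derivative of the product into a sum, which is the pole field.
  have hexp : ∀ y, poleWeight a α ε y
      = Real.exp (∑ i, Real.log (‖y - a i‖ ^ 2 + ε) * α) := by
    intro y
    rw [Real.exp_sum]
    exact Finset.prod_congr rfl fun i _ => Real.rpow_def_of_pos (by positivity) _
  have h : HasFDerivAt (fun y => Real.exp (∑ i, Real.log (‖y - a i‖ ^ 2 + ε) * α))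
      (Real.exp (∑ i, Real.log (‖x - a i‖ ^ 2 + ε) * α) •
        ∑ i, α • (‖x - a i‖ ^ 2 + ε)⁻¹ • (2 • innerSL ℝ (x - a i))) x :=
    (HasFDerivAt.fun_sum fun i _ =>
      ((hasFDerivAt_norm_sub_sq_add (a i) ε x).log (by positivity)).mul_const α).exp
  rw [funext hexp, h.fderiv, ← hexp, ← funext hexp]
  simp only [poleField, smul_apply, sum_apply,
    innerSL_apply_apply, smul_eq_mul, nsmul_eq_mul, sum_inner, inner_smul_left, Finset.mul_sum]
  refine Finset.sum_congr rfl fun i _ => ?_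
  push_cast
  simp
  ring

/-- The exponent of the weight equals the coefficient α of the pole field so that the derivative of
the weight along x, namely 2αΦ⟨W, x⟩, cancels the cross term of |G|². The index `none` carries the
extra field, centred at 0. -/
theorem integral_sq_mul_poleDensity_le [FiniteDimensional ℝ E] [MeasurableSpace E] [BorelSpace E]
    {φ : E → ℝ} (hφ : ContDiff ℝ 1 φ) (hφs : HasCompactSupport φ) (a : ι → E) (α t : ℝ)
    {ε : ℝ} (hε : 0 < ε) :
    ∫ x, φ x ^ 2 * poleDensity a (Module.finrank ℝ E) α t ε x ≤ ∫ x, ‖gradient φ x‖ ^ 2 := by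
  let g : Option ι → E → ℝ := fun o => o.elim (fun x => t * poleWeight a α ε x)
    (fun i x => α * (‖x - a i‖ ^ 2 + ε)⁻¹)
  let b : Option ι → E := fun o => o.elim 0 a
  have hg : ∀ o, ContDiff ℝ 1 (g o) := by
    rintro (_ | i)
    · exact contDiff_const.mul (contDiff_poleWeight a α hε)
    · exact contDiff_const.mul (contDiff_inv_norm_sub_sq_add (a i) hε)
  convert integral_sq_mul_div_sub_norm_sq_le hφ hφs hg b using 5 with x
  rw [Fintype.sum_option, Fintype.sum_option]
  have h1 : fderiv ℝ (g none) x (x - b none)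
      = t * (2 * α * poleWeight a α ε x * inner ℝ (poleField a ε x) x) := by
    have : HasFDerivAt (g none) _ x := (((contDiff_poleWeight a α hε (m := 1)).differentiable
      one_ne_zero x).hasFDerivAt.const_mul t)
    rw [this.fderiv]
    simp [b, fderiv_poleWeight_apply a α hε]
  have h2 : ∀ i, fderiv ℝ (g (some i)) x (x - b (some i))
      = α * -(2 * ‖x - a i‖ ^ 2 * ((‖x - a i‖ ^ 2 + ε) ^ 2)⁻¹) := by
    intro i
    have : HasFDerivAt (g (some i)) _ x := (((contDiff_inv_norm_sub_sq_add (a i) hε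
      (m := 1)).differentiable one_ne_zero x).hasFDerivAt.const_mul α)
    rw [this.fderiv, ← fderiv_inv_norm_sub_sq_add_apply (a i) hε]
    simp [b]
  have h3 : ∑ i, g (some i) x • (x - b (some i)) = α • poleField a ε x := by
    simp [g, b, poleField, Finset.smul_sum, mul_smul]
  have h4 : g none x • (x - b none) = (t * poleWeight a α ε x) • x := by simp [g, b]
  have h5 : ∑ i, ((Module.finrank ℝ E : ℝ) * g (some i) x
        + fderiv ℝ (g (some i)) x (x - b (some i)))
      = α * ∑ i, ((Module.finrank ℝ E : ℝ) * (‖x - a i‖ ^ 2 + ε)⁻¹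
        - 2 * ‖x - a i‖ ^ 2 * ((‖x - a i‖ ^ 2 + ε) ^ 2)⁻¹) := by
    rw [Finset.mul_sum]
    refine Finset.sum_congr rfl fun i _ => ?_
    rw [h2]
    simp only [g, Option.elim]
    ring
  rw [h1, h5, h3, h4, norm_add_sq_real, inner_smul_left, inner_smul_right, norm_smul, norm_smul,
    mul_pow, mul_pow, Real.norm_eq_abs, Real.norm_eq_abs, sq_abs, sq_abs, real_inner_comm x]
  simp only [poleDensity, g, Option.elim, RCLike.conj_to_real]
  ring

end Regularization

/-! ### Bounds uniform in ε -/

section Bounds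

variable {E : Type*} [NormedAddCommGroup E] {ι : Type*} [Fintype ι]

theorem poleWeight_nonneg (a : ι → E) (α : ℝ) {ε : ℝ} (hε : 0 ≤ ε) (x : E) :
    0 ≤ poleWeight a α ε x :=
  Finset.prod_nonneg fun i _ => by positivity

theorem poleWeight_mono (a : ι → E) {α : ℝ} (hα : 0 ≤ α) {ε δ : ℝ} (hε : 0 ≤ ε) (h : ε ≤ δ)
    (x : E) : poleWeight a α ε x ≤ poleWeight a α δ x :=
  Finset.prod_le_prod (fun i _ => by positivity) fun i _ => by gcongr

theorem continuous_poleWeight (a : ι → E) {α : ℝ} (hα : 0 ≤ α) (ε : ℝ) :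
    Continuous (poleWeight a α ε) :=
  continuous_finsetProd _ fun i _ =>
    Continuous.rpow_const (by fun_prop) fun x => Or.inr hα

variable [InnerProductSpace ℝ E]

theorem norm_poleField_sq_le (a : ι → E) {ε : ℝ} (hε : 0 ≤ ε) {x : E} (hx : ∀ i, x ≠ a i) :
    ‖poleField a ε x‖ ^ 2 ≤ Fintype.card ι * ∑ i, (‖x - a i‖ ^ 2)⁻¹ := by
  have h1 : ‖poleField a ε x‖ ≤ ∑ i, ‖x - a i‖⁻¹ := by
    refine (norm_sum_le _ _).trans (Finset.sum_le_sum fun i _ => ?_)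
    have hr : 0 < ‖x - a i‖ := norm_pos_iff.mpr (sub_ne_zero.mpr (hx i))
    rw [norm_smul, norm_inv, Real.norm_of_nonneg (by positivity), inv_mul_le_iff₀ (by positivity),
      ← div_eq_mul_inv, le_div_iff₀ hr]
    nlinarith
  calc ‖poleField a ε x‖ ^ 2 ≤ (∑ i, ‖x - a i‖⁻¹) ^ 2 := by gcongr
    _ ≤ Fintype.card ι * ∑ i, (‖x - a i‖⁻¹) ^ 2 := sq_sum_le_card_mul_sum_sq
    _ = _ := by simp [inv_pow]

theorem poleDensity_zero (a : ι → E) (N α t : ℝ) {x : E} (hx : ∀ i, x ≠ a i) :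
    poleDensity a N α t 0 x = α * (N - 2) * ∑ i, (‖x - a i‖ ^ 2)⁻¹
      - α ^ 2 * ‖poleField a 0 x‖ ^ 2
      + (t * N * poleWeight a α 0 x - t ^ 2 * (poleWeight a α 0 x ^ 2 * ‖x‖ ^ 2)) := by
  unfold poleDensity
  congr 2
  rw [mul_assoc, Finset.mul_sum (a := N - 2)]
  congr 1
  refine Finset.sum_congr rfl fun i _ => ?_
  have hr : ‖x - a i‖ ≠ 0 := norm_ne_zero_iff.mpr (sub_ne_zero.mpr (hx i))
  field_simp
  ring

/-- The majorant is free of ε, as dominated convergence requires; the weight increases with ε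
because α ≥ 0, hence its value at ε = 1. -/
theorem abs_poleDensity_le (a : ι → E) {N α : ℝ} (hN : 0 ≤ N) (hα : 0 ≤ α) (t : ℝ) {ε : ℝ}
    (hε : 0 ≤ ε) (hε1 : ε ≤ 1) {x : E} (hx : ∀ i, x ≠ a i) :
    |poleDensity a N α t ε x| ≤ (α * (N + 2) + α ^ 2 * Fintype.card ι) * ∑ i, (‖x - a i‖ ^ 2)⁻¹
      + (|t| * N * poleWeight a α 1 x + t ^ 2 * (poleWeight a α 1 x ^ 2 * ‖x‖ ^ 2)) := by
  have h1 : |∑ i, (N * (‖x - a i‖ ^ 2 + ε)⁻¹ - 2 * ‖x - a i‖ ^ 2 * ((‖x - a i‖ ^ 2 + ε) ^ 2)⁻¹)|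
      ≤ (N + 2) * ∑ i, (‖x - a i‖ ^ 2)⁻¹ := by
    rw [Finset.mul_sum]
    refine (Finset.abs_sum_le_sum_abs _ _).trans (Finset.sum_le_sum fun i _ => ?_)
    have hr : 0 < ‖x - a i‖ := norm_pos_iff.mpr (sub_ne_zero.mpr (hx i))
    have hle : (‖x - a i‖ ^ 2 + ε)⁻¹ ≤ (‖x - a i‖ ^ 2)⁻¹ := by gcongr; linarith
    have hle2 : ‖x - a i‖ ^ 2 * ((‖x - a i‖ ^ 2 + ε) ^ 2)⁻¹ ≤ (‖x - a i‖ ^ 2)⁻¹ := by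
      rw [← div_eq_mul_inv, div_le_iff₀ (by positivity), inv_mul_eq_div, le_div_iff₀ (by positivity)]
      nlinarith [mul_nonneg (sq_nonneg ‖x - a i‖) hε]
    have h0 : 0 ≤ ‖x - a i‖ ^ 2 * ((‖x - a i‖ ^ 2 + ε) ^ 2)⁻¹ := by positivity
    have h0' : 0 ≤ (‖x - a i‖ ^ 2 + ε)⁻¹ := by positivity
    rw [abs_le]
    constructor <;> nlinarith [mul_le_mul_of_nonneg_left hle hN, mul_nonneg hN h0']
  have h2 := norm_poleField_sq_le a hε hx
  have h3 := poleWeight_mono a hα hε hε1 x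
  have h4 := poleWeight_nonneg a α hε x
  unfold poleDensity
  calc _ ≤ |α * ∑ i, (N * (‖x - a i‖ ^ 2 + ε)⁻¹
            - 2 * ‖x - a i‖ ^ 2 * ((‖x - a i‖ ^ 2 + ε) ^ 2)⁻¹)|
          + |α ^ 2 * ‖poleField a ε x‖ ^ 2|
          + (|t * N * poleWeight a α ε x| + |t ^ 2 * (poleWeight a α ε x ^ 2 * ‖x‖ ^ 2)|) :=
        (abs_add_le _ _).trans (add_le_add (abs_sub _ _) (abs_sub _ _))
    _ ≤ α * ((N + 2) * ∑ i, (‖x - a i‖ ^ 2)⁻¹)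
          + α ^ 2 * (Fintype.card ι * ∑ i, (‖x - a i‖ ^ 2)⁻¹)
          + (|t| * N * poleWeight a α 1 x + t ^ 2 * (poleWeight a α 1 x ^ 2 * ‖x‖ ^ 2)) := by
        rw [abs_mul α, abs_of_nonneg hα, abs_of_nonneg (a := α ^ 2 * _) (by positivity),
          abs_mul (t * N), abs_mul t, abs_of_nonneg hN, abs_of_nonneg h4,
          abs_of_nonneg (a := t ^ 2 * _) (by positivity)]
        gcongr
    _ = _ := by ring

end Bounds

/-! ### Removing the regularization -/

section Limit

variable {E : Type*} [NormedAddCommGroup E] [InnerProductSpace ℝ E] [FiniteDimensional ℝ E]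
  [MeasurableSpace E] [BorelSpace E] {ι : Type*} [Fintype ι]

/-- In polar coordinates the integrand becomes r^(N-3), which is bounded near 0 exactly when N ≥ 3.
-/
theorem locallyIntegrable_inv_norm_sub_sq (hE : 3 ≤ Module.finrank ℝ E) (a : E) :
    LocallyIntegrable fun x => (‖x - a‖ ^ 2)⁻¹ := by
  have : Nontrivial E := Module.nontrivial_of_finrank_pos (R := ℝ) (by omega)
  have hball : ∀ R : ℝ, IntegrableOn (fun x : E => (‖x‖ ^ 2)⁻¹) (Metric.ball 0 R) := by
    intro R
    rw [integrableOn_fun_norm_addHaar volume (f := fun y : ℝ => (y ^ 2)⁻¹)]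
    have h : IntegrableOn (fun y : ℝ => y ^ (Module.finrank ℝ E - 3)) (Set.Ioo 0 R) :=
      ((continuous_pow _).continuousOn.integrableOn_compact isCompact_Icc).mono_set
        Set.Ioo_subset_Icc_self
    refine h.congr_fun (fun y hy => ?_) measurableSet_Ioo
    have hy0 : y ≠ 0 := hy.1.ne'
    obtain ⟨k, hk⟩ := Nat.exists_eq_add_of_le hE
    have h1 : Module.finrank ℝ E - 3 = k := by omega
    have h2 : Module.finrank ℝ E - 1 = k + 2 := by omega
    simp only [h1, h2, smul_eq_mul]
    field_simp
    ring
  intro x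
  refine ⟨Metric.ball a (dist x a + 1), Metric.isOpen_ball.mem_nhds (by simp), ?_⟩
  have h := ((integrable_indicator_iff Metric.isOpen_ball.measurableSet).mpr
    (hball (dist x a + 1))).comp_sub_right a
  refine (integrable_indicator_iff Metric.isOpen_ball.measurableSet).mp (h.congr ?_)
  filter_upwards with y
  simp [Set.indicator, dist_eq_norm]

theorem integrable_sq_mul_inv_norm_sub_sq (hE : 3 ≤ Module.finrank ℝ E) {φ : E → ℝ}
    (hφ : Continuous φ) (hφs : HasCompactSupport φ) (a : E) :
    Integrable fun x => φ x ^ 2 * (‖x - a‖ ^ 2)⁻¹ :=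
  (locallyIntegrable_inv_norm_sub_sq hE a).integrable_smul_left_of_hasCompactSupport
    (g := fun x => φ x ^ 2) (hφ.pow 2) (hφs.comp_left (g := fun t : ℝ => t ^ 2) (by simp))

theorem ae_forall_ne_pole (hE : 1 ≤ Module.finrank ℝ E) (a : ι → E) :
    ∀ᵐ x : E, ∀ i, x ≠ a i := by
  have : Nontrivial E := Module.nontrivial_of_finrank_pos (R := ℝ) (by omega)
  exact ae_all_iff.mpr fun i => Measure.ae_ne volume (a i)

/-- The Hardy inequality with density `poleDensity a N α t 0`. -/
theorem integral_sq_mul_poleDensity_zero_le (hE : 3 ≤ Module.finrank ℝ E) {φ : E → ℝ}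
    (hφ : ContDiff ℝ 1 φ) (hφs : HasCompactSupport φ) (a : ι → E) {α : ℝ} (hα : 0 ≤ α) (t : ℝ) :
    Integrable (fun x => φ x ^ 2 * poleDensity a (Module.finrank ℝ E) α t 0 x) ∧
    ∫ x, φ x ^ 2 * poleDensity a (Module.finrank ℝ E) α t 0 x ≤ ∫ x, ‖gradient φ x‖ ^ 2 := by
  set N : ℝ := (Module.finrank ℝ E : ℝ)
  have hN : 0 ≤ N := Nat.cast_nonneg _
  have hφ2s : HasCompactSupport fun y => φ y ^ 2 :=
    hφs.comp_left (g := fun t : ℝ => t ^ 2) (by simp)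
  have hφc := hφ.continuous
  let bound : E → ℝ := fun x => φ x ^ 2 *
    ((α * (N + 2) + α ^ 2 * Fintype.card ι) * ∑ i, (‖x - a i‖ ^ 2)⁻¹
      + (|t| * N * poleWeight a α 1 x + t ^ 2 * (poleWeight a α 1 x ^ 2 * ‖x‖ ^ 2)))
  have hbound : Integrable bound := by
    have h1 : Integrable fun x => (α * (N + 2) + α ^ 2 * Fintype.card ι)
        * ∑ i, φ x ^ 2 * (‖x - a i‖ ^ 2)⁻¹ :=
      (integrable_finsetSum _ fun i _ =>
        integrable_sq_mul_inv_norm_sub_sq hE hφc hφs (a i)).const_mul _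
    have h2 : Integrable fun x => φ x ^ 2 * (|t| * N * poleWeight a α 1 x
        + t ^ 2 * (poleWeight a α 1 x ^ 2 * ‖x‖ ^ 2)) := by
      have := continuous_poleWeight a hα 1
      exact Continuous.integrable_of_hasCompactSupport (by fun_prop) hφ2s.mul_right
    refine (h1.add h2).congr (Eventually.of_forall fun x => ?_)
    simp only [bound, Pi.add_apply, ← Finset.mul_sum]
    ring
  have hmeas : ∀ ε, AEStronglyMeasurable fun x => φ x ^ 2 * poleDensity a N α t ε x := by
    intro ε
    have h1 : Measurable (poleField a ε) := by unfold poleField; fun_prop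
    have h2 := (continuous_poleWeight a hα ε).measurable
    have h3 := hφc.measurable
    refine Measurable.aestronglyMeasurable ?_
    unfold poleDensity
    fun_prop
  have hdom : ∀ ε, 0 ≤ ε → ε ≤ 1 →
      ∀ᵐ x, ‖φ x ^ 2 * poleDensity a N α t ε x‖ ≤ bound x := by
    intro ε h0 h1
    filter_upwards [ae_forall_ne_pole (by omega) a] with x hx
    rw [norm_mul, Real.norm_of_nonneg (sq_nonneg _), Real.norm_eq_abs]
    exact mul_le_mul_of_nonneg_left (abs_poleDensity_le a hN hα t h0 h1 hx) (sq_nonneg _)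
  refine ⟨hbound.mono' (hmeas 0) (hdom 0 le_rfl zero_le_one), ?_⟩
  have hlim : Tendsto (fun k : ℕ => ∫ x, φ x ^ 2 * poleDensity a N α t (1 / ((k : ℝ) + 1)) x)
      atTop (𝓝 (∫ x, φ x ^ 2 * poleDensity a N α t 0 x)) := by
    refine tendsto_integral_of_dominated_convergence bound (fun k => hmeas _) hbound
      (fun k => hdom _ (by positivity) ?_) ?_
    · rw [div_le_one (by positivity)]
      have : (0 : ℝ) ≤ k := Nat.cast_nonneg k
      linarith
    · filter_upwards [ae_forall_ne_pole (by omega) a] with x hx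
      have hr : ∀ i, ‖x - a i‖ ^ 2 + 0 ≠ 0 := fun i => by
        simpa using sub_ne_zero.mpr (hx i)
      have hcont : ContinuousAt (fun ε : ℝ => φ x ^ 2 * poleDensity a N α t ε x) 0 := by
        have h0 : ∀ i, ContinuousAt (fun ε : ℝ => ‖x - a i‖ ^ 2 + ε) 0 := fun i => by fun_prop
        have h1 : ∀ i, ContinuousAt (fun ε : ℝ => (‖x - a i‖ ^ 2 + ε)⁻¹) 0 :=
          fun i => (h0 i).inv₀ (hr i)
        have h1' : ∀ i, ContinuousAt (fun ε : ℝ => ((‖x - a i‖ ^ 2 + ε) ^ 2)⁻¹) 0 :=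
          fun i => ((h0 i).pow 2).inv₀ (pow_ne_zero 2 (hr i))
        have h2 : ContinuousAt (fun ε : ℝ => poleField a ε x) 0 :=
          tendsto_finsetSum _ fun i _ => (h1 i).smul continuousAt_const
        have h3 : ContinuousAt (fun ε : ℝ => poleWeight a α ε x) 0 :=
          tendsto_finsetProd _ fun i _ => (h0 i).rpow_const (Or.inl (hr i))
        have h4 : ContinuousAt (fun ε : ℝ => ∑ i, (N * (‖x - a i‖ ^ 2 + ε)⁻¹
            - 2 * ‖x - a i‖ ^ 2 * ((‖x - a i‖ ^ 2 + ε) ^ 2)⁻¹)) 0 :=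
          tendsto_finsetSum _ fun i _ => ((h1 i).const_mul N).sub ((h1' i).const_mul _)
        unfold poleDensity
        fun_prop
      exact hcont.tendsto.comp tendsto_one_div_add_atTop_nhds_zero_nat
  exact le_of_tendsto' hlim fun k =>
    integral_sq_mul_poleDensity_le hφ hφs a α t (by positivity)

end Limit

/-! ### The potential as a Lagrange identity -/

section Potential

/-- Lagrange's identity: sum over all ordered pairs, where the diagonal vanishes, and halve. -/
theorem sum_Ioi_norm_sub_sq {E : Type*} [NormedAddCommGroup E] [InnerProductSpace ℝ E] {n : ℕ}
    (w : Fin n → E) :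
    ∑ i, ∑ j ∈ Finset.Ioi i, ‖w i - w j‖ ^ 2 = n * ∑ i, ‖w i‖ ^ 2 - ‖∑ i, w i‖ ^ 2 := by
  have h := Finset.sum_sum_Ioi_add_eq_sum_sum_off_diag fun i j => ‖w i - w j‖ ^ 2
  have h1 : ∑ i, ∑ j ∈ Finset.Ioi i, (‖w j - w i‖ ^ 2 + ‖w i - w j‖ ^ 2)
      = 2 * ∑ i, ∑ j ∈ Finset.Ioi i, ‖w i - w j‖ ^ 2 := by
    simp_rw [Finset.mul_sum]
    refine Finset.sum_congr rfl fun i _ => Finset.sum_congr rfl fun j _ => ?_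
    rw [norm_sub_rev (w j)]
    ring
  have h2 : ∑ i, ∑ j ∈ ({i}ᶜ : Finset (Fin n)), ‖w j - w i‖ ^ 2
      = ∑ i, ∑ j, ‖w j - w i‖ ^ 2 := by
    refine Finset.sum_congr rfl fun i _ => ?_
    refine Finset.sum_subset (Finset.subset_univ _) fun j _ hj => ?_
    have : j = i := by simpa using hj
    simp [this]
  have h3 : ∑ i, ∑ j, ‖w j - w i‖ ^ 2 = 2 * (n * ∑ i, ‖w i‖ ^ 2 - ‖∑ i, w i‖ ^ 2) := by
    simp_rw [norm_sub_sq_real]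
    rw [← real_inner_self_eq_norm_sq (∑ i, w i)]
    simp only [Finset.sum_add_distrib, Finset.sum_sub_distrib, sum_inner, inner_sum,
      Finset.sum_const, Finset.card_univ, Fintype.card_fin, nsmul_eq_mul, ← Finset.mul_sum]
    rw [Finset.sum_comm (f := fun i j => inner ℝ (w j) (w i))]
    ring
  rw [h1, h2, h3] at h
  linarith

theorem potential_eq {N n : ℕ} (a : Fin n → EuclideanSpace ℝ (Fin N))
    {x : EuclideanSpace ℝ (Fin N)} (hx : ∀ i, x ≠ a i) :
    potential a x = n * ∑ i, (‖x - a i‖ ^ 2)⁻¹ - ‖poleField a 0 x‖ ^ 2 := by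
  have hr : ∀ i, ‖x - a i‖ ≠ 0 := fun i => norm_ne_zero_iff.mpr (sub_ne_zero.mpr (hx i))
  have h1 : ∀ i, ‖(‖x - a i‖ ^ 2)⁻¹ • (x - a i)‖ ^ 2 = (‖x - a i‖ ^ 2)⁻¹ := by
    intro i
    have := hr i
    rw [norm_smul, norm_inv, norm_pow, norm_norm]
    field_simp
  have h := sum_Ioi_norm_sub_sq fun i => (‖x - a i‖ ^ 2)⁻¹ • (x - a i)
  simp only [h1] at h
  simp only [poleField, add_zero]
  rw [← h, potential]
  refine Finset.sum_congr rfl fun i _ => Finset.sum_congr rfl fun j _ => ?_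
  -- The w_i are the images of x - a_i under inversion in the unit sphere, whose distance formula
  -- produces the summands of V.
  have hd := dist_div_norm_sq_smul (sub_ne_zero.mpr (hx i)) (sub_ne_zero.mpr (hx j)) 1
  simp only [one_pow, inv_pow, one_div, dist_eq_norm, sub_sub_sub_cancel_left] at hd
  rw [hd, norm_sub_rev (a j)]
  have := hr i
  have := hr j
  field_simp

end Potential

/-! ### From test functions to the completion -/

section Completion

variable {N n : ℕ}

theorem measurable_potential (a : Fin n → EuclideanSpace ℝ (Fin N)) :
    Measurable (potential a) := by
  unfold potential
  fun_prop

theorem potential_nonneg (a : Fin n → EuclideanSpace ℝ (Fin N)) (x : EuclideanSpace ℝ (Fin N)) :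
    0 ≤ potential a x :=
  Finset.sum_nonneg fun i _ => Finset.sum_nonneg fun j _ => by positivity

theorem potential_pos (hn : 2 ≤ n) {a : Fin n → EuclideanSpace ℝ (Fin N)}
    (ha : Function.Injective a) {x : EuclideanSpace ℝ (Fin N)} (hx : ∀ i, x ≠ a i) :
    0 < potential a x := by
  have hr : ∀ i, 0 < ‖x - a i‖ := fun i => norm_pos_iff.mpr (sub_ne_zero.mpr (hx i))
  let i : Fin n := ⟨0, by omega⟩
  let j : Fin n := ⟨1, by omega⟩
  have hij : i < j := by simp [i, j, Fin.lt_def]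
  have haij : 0 < ‖a i - a j‖ := norm_pos_iff.mpr (sub_ne_zero.mpr (ha.ne hij.ne))
  refine Finset.sum_pos' (fun i _ => Finset.sum_nonneg fun j _ => by positivity)
    ⟨i, Finset.mem_univ _, ?_⟩
  refine Finset.sum_pos' (fun j _ => by positivity) ⟨j, Finset.mem_Ioi.mpr hij, ?_⟩
  have := hr i
  have := hr j
  positivity

theorem continuous_gradient_testFunction {Ω : Opens (EuclideanSpace ℝ (Fin N))} (φ : 𝓓(Ω, ℝ)) :
    Continuous (gradient φ) :=
  (InnerProductSpace.toDual ℝ _).symm.continuous.comp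
    (φ.contDiff.continuous_fderiv (by simp))

theorem hasCompactSupport_gradient_testFunction {Ω : Opens (EuclideanSpace ℝ (Fin N))}
    (φ : 𝓓(Ω, ℝ)) : HasCompactSupport (gradient φ) :=
  (φ.hasCompactSupport.fderiv ℝ).comp_left
    (map_zero (InnerProductSpace.toDual ℝ (EuclideanSpace ℝ (Fin N))).symm)

theorem support_gradient_testFunction_subset {Ω : Opens (EuclideanSpace ℝ (Fin N))}
    (φ : 𝓓(Ω, ℝ)) : Function.support (gradient φ) ⊆ Ω := by
  intro x hx
  refine φ.tsupport_subset (support_fderiv_subset ℝ (f := φ) ?_)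
  contrapose! hx
  simp [gradient, Function.notMem_support.mp hx]

theorem lintegral_ofReal_norm_sq {α F : Type*} [MeasurableSpace α] {μ : Measure α}
    [NormedAddCommGroup F] (f : α → F) :
    ∫⁻ x, ENNReal.ofReal (‖f x‖ ^ 2) ∂μ = eLpNorm f 2 μ ^ 2 := by
  have h := eLpNorm_nnreal_pow_eq_lintegral (f := f) (p := 2) (μ := μ) two_ne_zero
  simp only [NNReal.coe_ofNat, ENNReal.coe_ofNat, ENNReal.rpow_ofNat] at h
  rw [h]
  refine lintegral_congr fun x => ?_
  rw [ENNReal.ofReal_pow (norm_nonneg _), ofReal_norm]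

/-- A Hardy inequality with Bochner integrals over the whole space, restated with Lebesgue
integrals over `Ω`. -/
theorem ofReal_mul_lintegral_le_of_integral_le {Ω : Opens (EuclideanSpace ℝ (Fin N))}
    {a : Fin n → EuclideanSpace ℝ (Fin N)} {c : ℝ} (φ : 𝓓(Ω, ℝ))
    (hint : Integrable fun x => φ x ^ 2 * potential a x)
    (hle : c * ∫ x, φ x ^ 2 * potential a x ≤ ∫ x, ‖gradient φ x‖ ^ 2) :
    ENNReal.ofReal c * ∫⁻ x in Ω, ENNReal.ofReal (potential a x * φ x ^ 2)
      ≤ ∫⁻ x in Ω, ENNReal.ofReal (‖gradient φ x‖ ^ 2) := by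
  have hgrad := continuous_gradient_testFunction φ
  have hnn : ∀ x, 0 ≤ φ x ^ 2 * potential a x :=
    fun x => mul_nonneg (sq_nonneg _) (potential_nonneg a x)
  calc ENNReal.ofReal c * ∫⁻ x in Ω, ENNReal.ofReal (potential a x * φ x ^ 2)
      ≤ ENNReal.ofReal c * ∫⁻ x, ENNReal.ofReal (potential a x * φ x ^ 2) := by
        gcongr
        exact Measure.restrict_le_self
    _ = ENNReal.ofReal c * ENNReal.ofReal (∫ x, φ x ^ 2 * potential a x) := by
        rw [ofReal_integral_eq_lintegral_ofReal hint (Eventually.of_forall hnn)]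
        simp_rw [mul_comm]
    _ = ENNReal.ofReal (c * ∫ x, φ x ^ 2 * potential a x) :=
        (ENNReal.ofReal_mul' (integral_nonneg hnn)).symm
    _ ≤ ENNReal.ofReal (∫ x, ‖gradient φ x‖ ^ 2) := ENNReal.ofReal_le_ofReal hle
    _ = ∫⁻ x, ENNReal.ofReal (‖gradient φ x‖ ^ 2) :=
        ofReal_integral_eq_lintegral_ofReal
          (Continuous.integrable_of_hasCompactSupport (by fun_prop)
            ((hasCompactSupport_gradient_testFunction φ).comp_left (g := fun v => ‖v‖ ^ 2)
              (by simp)))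
          (Eventually.of_forall fun x => by positivity)
    _ = ∫⁻ x in Ω, ENNReal.ofReal (‖gradient φ x‖ ^ 2) := by
        refine (setLIntegral_eq_of_support_subset (fun x hx => ?_)).symm
        refine support_gradient_testFunction_subset φ ?_
        contrapose! hx
        simp [Function.notMem_support.mp hx]

/-- A Hardy inequality for test functions extends to `D^{1,2}_0(Ω)`. -/
theorem MemD12.ofReal_mul_lintegral_le (hN : 3 ≤ N) {Ω : Opens (EuclideanSpace ℝ (Fin N))}
    {a : Fin n → EuclideanSpace ℝ (Fin N)} {c : ℝ}
    (h : ∀ φ : 𝓓(Ω, ℝ), ENNReal.ofReal c * ∫⁻ x in Ω, ENNReal.ofReal (potential a x * φ x ^ 2)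
      ≤ ∫⁻ x in Ω, ENNReal.ofReal (‖gradient φ x‖ ^ 2))
    {u : EuclideanSpace ℝ (Fin N) → ℝ} {G : EuclideanSpace ℝ (Fin N) → EuclideanSpace ℝ (Fin N)}
    (hu : MemD12 Ω u G) :
    ENNReal.ofReal c * ∫⁻ x in Ω, ENNReal.ofReal (potential a x * u x ^ 2)
      ≤ ∫⁻ x in Ω, ENNReal.ofReal (‖G x‖ ^ 2) := by
  set μ : Measure (EuclideanSpace ℝ (Fin N)) := volume.restrict Ω with hμ
  obtain ⟨φ, hφu, hφG⟩ := hu.approx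
  have hp : sobolevExponent N ≠ 0 := by
    have h3 : (3 : ℝ) ≤ N := by exact_mod_cast hN
    rw [sobolevExponent, ENNReal.ofReal_ne_zero_iff]
    exact div_pos (by linarith) (by linarith)
  -- An a.e. convergent subsequence suffices: Fatou then handles V u² without knowing beforehand
  -- that it is integrable.
  obtain ⟨s, hs, hsae⟩ := (tendstoInMeasure_of_tendsto_eLpNorm (f := fun k => ⇑(φ k)) hp
    (fun k => (φ k).continuous.aestronglyMeasurable) hu.memLp.1 hφu).exists_seq_tendsto_ae
  have hbound : ∀ k, ENNReal.ofReal c * ∫⁻ x, ENNReal.ofReal (potential a x * φ (s k) x ^ 2) ∂μ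
      ≤ (eLpNorm (fun x => gradient (φ (s k)) x - G x) 2 μ + eLpNorm G 2 μ) ^ 2 := by
    intro k
    refine (h (φ (s k))).trans ?_
    rw [lintegral_ofReal_norm_sq]
    gcongr
    have hmeas := (continuous_gradient_testFunction (φ (s k))).aestronglyMeasurable (μ := μ)
    have := eLpNorm_add_le (hmeas.sub hu.memLp_grad.1) hu.memLp_grad.1 one_le_two
    rwa [sub_add_cancel] at this
  have hlim : Tendsto (fun k => (eLpNorm (fun x => gradient (φ (s k)) x - G x) 2 μ
      + eLpNorm G 2 μ) ^ 2) atTop (𝓝 (eLpNorm G 2 μ ^ 2)) := by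
    have h1 := (hφG.comp hs.tendsto_atTop).add_const (eLpNorm G 2 μ)
    rw [zero_add] at h1
    exact ((ENNReal.continuous_pow 2).tendsto _).comp h1
  have hmeasV := measurable_potential a
  have hmeasφ : ∀ k, Measurable (φ (s k)) := fun k => (φ (s k)).continuous.measurable
  have hmeasu := hu.memLp.1.aemeasurable
  calc ENNReal.ofReal c * ∫⁻ x, ENNReal.ofReal (potential a x * u x ^ 2) ∂μ
      = ∫⁻ x, ENNReal.ofReal c * ENNReal.ofReal (potential a x * u x ^ 2) ∂μ :=
        (lintegral_const_mul' _ _ ENNReal.ofReal_ne_top).symm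
    _ = ∫⁻ x, liminf (fun k => ENNReal.ofReal c
          * ENNReal.ofReal (potential a x * φ (s k) x ^ 2)) atTop ∂μ := by
        refine lintegral_congr_ae ?_
        filter_upwards [hsae] with x hx
        refine (Tendsto.liminf_eq ?_).symm
        exact ENNReal.Tendsto.const_mul (ENNReal.tendsto_ofReal ((hx.pow 2).const_mul _))
          (Or.inr ENNReal.ofReal_ne_top)
    _ ≤ liminf (fun k => ∫⁻ x, ENNReal.ofReal c
          * ENNReal.ofReal (potential a x * φ (s k) x ^ 2) ∂μ) atTop :=
        lintegral_liminf_le fun k => by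
          have := hmeasφ k
          fun_prop
    _ ≤ liminf (fun k => (eLpNorm (fun x => gradient (φ (s k)) x - G x) 2 μ
          + eLpNorm G 2 μ) ^ 2) atTop := by
        refine liminf_le_liminf (Eventually.of_forall fun k => ?_)
        rw [lintegral_const_mul' _ _ ENNReal.ofReal_ne_top]
        exact hbound k
    _ = eLpNorm G 2 μ ^ 2 := hlim.liminf_eq
    _ = ∫⁻ x, ENNReal.ofReal (‖G x‖ ^ 2) ∂μ := (lintegral_ofReal_norm_sq G).symm

/-- Division in `ℝ≥0∞` is safe: V > 0 almost everywhere makes the denominator nonzero, and a finite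
numerator covers an infinite denominator. -/
theorem ofReal_le_hardyConstant (hN : 3 ≤ N) (hn : 2 ≤ n)
    {Ω : Opens (EuclideanSpace ℝ (Fin N))} {a : Fin n → EuclideanSpace ℝ (Fin N)}
    (ha : Function.Injective a) {c : ℝ}
    (h : ∀ φ : 𝓓(Ω, ℝ), ENNReal.ofReal c * ∫⁻ x in Ω, ENNReal.ofReal (potential a x * φ x ^ 2)
      ≤ ∫⁻ x in Ω, ENNReal.ofReal (‖gradient φ x‖ ^ 2)) :
    ENNReal.ofReal c ≤ hardyConstant Ω a := by
  refine le_sInf ?_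
  rintro _ ⟨u, G, hu, hu0, rfl⟩
  have hden : ∫⁻ x in Ω, ENNReal.ofReal (potential a x * u x ^ 2) ≠ 0 := by
    have hmeasV := measurable_potential a
    have hmeasu := hu.memLp.1.aemeasurable
    rw [Ne, lintegral_eq_zero_iff' (by fun_prop)]
    contrapose! hu0
    filter_upwards [hu0, ae_restrict_of_ae (ae_forall_ne_pole (by simp; omega) a)] with x hx hxa
    have hV := potential_pos hn ha hxa
    have hle : potential a x * u x ^ 2 ≤ 0 := by simpa using hx
    have : u x ^ 2 ≤ 0 := nonpos_of_mul_nonpos_right hle hV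
    simpa using pow_eq_zero_iff two_ne_zero |>.mp (le_antisymm this (sq_nonneg _))
  have hnum : ∫⁻ x in Ω, ENNReal.ofReal (‖G x‖ ^ 2) ≠ ∞ := by
    rw [lintegral_ofReal_norm_sq]
    exact ENNReal.pow_ne_top hu.memLp_grad.2.ne
  rw [ENNReal.le_div_iff_mul_le (Or.inl hden) (Or.inr hnum)]
  exact hu.ofReal_mul_lintegral_le hN h

end Completion

/-! ### Lower bounds for the Hardy constant -/

section LowerBound

/-- Only the k-th term is singular at a k; the sum Z of the others is continuous there, so |W| ≤ 1/r
+ C, and rC is small. -/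
theorem exists_norm_poleField_sq_le_near_pole {E ι : Type*} [NormedAddCommGroup E]
    [InnerProductSpace ℝ E] [Fintype ι] {a : ι → E} (ha : Function.Injective a) (k : ι)
    {δ : ℝ} (hδ : 0 < δ) :
    ∃ R > 0, ∀ x, x ≠ a k → ‖x - a k‖ < R →
      ‖poleField a 0 x‖ ^ 2 ≤ (1 + δ) * (‖x - a k‖ ^ 2)⁻¹ := by
  classical
  let Z : E → E := fun x => ∑ j ∈ Finset.univ.erase k, (‖x - a j‖ ^ 2 + 0)⁻¹ • (x - a j)
  have hZ : ContinuousAt Z (a k) := by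
    refine tendsto_finsetSum _ fun j hj => ?_
    have hne : ‖a k - a j‖ ^ 2 + 0 ≠ 0 := by
      simpa [sub_eq_zero] using ha.ne (Finset.ne_of_mem_erase hj).symm
    have h1 : ContinuousAt (fun x => (‖x - a j‖ ^ 2 + 0)⁻¹) (a k) :=
      ContinuousAt.inv₀ (by fun_prop) hne
    exact h1.smul (by fun_prop)
  set C : ℝ := ‖Z (a k)‖ + 1 with hC
  have hCpos : 0 < C := by positivity
  obtain ⟨R, hR, hRZ⟩ := Metric.eventually_nhds_iff.mp
    (hZ.norm.eventually_lt continuousAt_const (lt_add_one ‖Z (a k)‖))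
  set s : ℝ := min 1 (δ / 3)
  have hs : 0 < s := lt_min one_pos (by positivity)
  have hs1 : s ≤ 1 := min_le_left _ _
  have hsδ : s ≤ δ / 3 := min_le_right _ _
  refine ⟨min R (s / C), lt_min hR (by positivity), fun x hxk hx => ?_⟩
  have hr : 0 < ‖x - a k‖ := norm_pos_iff.mpr (sub_ne_zero.mpr hxk)
  have hZx : ‖Z x‖ ≤ C := (hRZ (by rw [dist_eq_norm]; exact hx.trans_le (min_le_left _ _))).le
  have hrC : ‖x - a k‖ * C ≤ s := by
    have := hx.trans_le (min_le_right _ _)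
    rw [lt_div_iff₀ hCpos] at this
    exact this.le
  have hW : ‖poleField a 0 x‖ ≤ ‖x - a k‖⁻¹ + C := by
    have h1 : poleField a 0 x = (‖x - a k‖ ^ 2 + 0)⁻¹ • (x - a k) + Z x :=
      (Finset.add_sum_erase _ _ (Finset.mem_univ k)).symm
    have h2 : ‖(‖x - a k‖ ^ 2 + 0)⁻¹ • (x - a k)‖ = ‖x - a k‖⁻¹ := by
      rw [norm_smul, norm_inv, add_zero, norm_pow, norm_norm]
      field_simp
    rw [h1, ← h2]
    exact (norm_add_le _ _).trans (by gcongr)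
  calc ‖poleField a 0 x‖ ^ 2 ≤ (‖x - a k‖⁻¹ + C) ^ 2 := by gcongr
    _ = (1 + ‖x - a k‖ * C) ^ 2 * (‖x - a k‖ ^ 2)⁻¹ := by field_simp
    _ ≤ (1 + s) ^ 2 * (‖x - a k‖ ^ 2)⁻¹ := by gcongr
    _ ≤ (1 + δ) * (‖x - a k‖ ^ 2)⁻¹ := by
      gcongr
      nlinarith

theorem poleWeight_zero_pos {E ι : Type*} [NormedAddCommGroup E] [Fintype ι] (a : ι → E) (α : ℝ)
    {x : E} (hx : ∀ i, x ≠ a i) : 0 < poleWeight a α 0 x :=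
  Finset.prod_pos fun i _ => by
    have : 0 < ‖x - a i‖ := norm_pos_iff.mpr (sub_ne_zero.mpr (hx i))
    positivity

theorem inv_norm_sub_sq_le_sum {E ι : Type*} [NormedAddCommGroup E] [Fintype ι] (a : ι → E)
    (k : ι) (x : E) : (‖x - a k‖ ^ 2)⁻¹ ≤ ∑ i, (‖x - a i‖ ^ 2)⁻¹ :=
  Finset.single_le_sum (f := fun i => (‖x - a i‖ ^ 2)⁻¹) (fun i _ => by positivity)
    (Finset.mem_univ k)

variable {N n : ℕ}

/-- At each pole `|∑ w_i|²` is dominated by the potential, elsewhere by the weight. -/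
theorem exists_norm_poleField_sq_le_potential_add_poleWeight (hn : 3 ≤ n)
    {a : Fin n → EuclideanSpace ℝ (Fin N)} (ha : Function.Injective a) {α : ℝ} (hα : 0 ≤ α)
    {K : Set (EuclideanSpace ℝ (Fin N))} (hK : IsCompact K) :
    ∃ M ≥ 0, ∀ x ∈ K, (∀ i, x ≠ a i) →
      3 / 4 * ‖poleField a 0 x‖ ^ 2 ≤ 7 / 16 * potential a x + M * poleWeight a α 0 x := by
  -- By compactness it is enough to find M near each point; finitely many values are combined by a
  -- maximum.
  refine hK.induction_on (p := fun s => ∃ M ≥ 0, ∀ x ∈ s, (∀ i, x ≠ a i) →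
      3 / 4 * ‖poleField a 0 x‖ ^ 2 ≤ 7 / 16 * potential a x + M * poleWeight a α 0 x)
    ⟨0, le_rfl, by simp⟩ ?_ ?_ ?_
  · rintro s t hst ⟨M, hM, h⟩
    exact ⟨M, hM, fun x hx => h x (hst hx)⟩
  · rintro s t ⟨M, hM, h⟩ ⟨M', hM', h'⟩
    have hΦ := fun x => poleWeight_nonneg a α le_rfl x
    refine ⟨max M M', hM.le.trans (le_max_left _ _), ?_⟩
    rintro x (hx | hx) hxa
    · refine (h x hx hxa).trans ?_
      gcongr
      exacts [hΦ x, le_max_left _ _]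
    · refine (h' x hx hxa).trans ?_
      gcongr
      exacts [hΦ x, le_max_right _ _]
  · intro x₀ _
    by_cases hx₀ : ∀ i, x₀ ≠ a i
    · have hr : ∀ i, ‖x₀ - a i‖ ^ 2 + 0 ≠ 0 := fun i => by
        simpa using sub_ne_zero.mpr (hx₀ i)
      have hW : ContinuousAt (poleField a 0) x₀ :=
        tendsto_finsetSum _ fun i _ =>
          (ContinuousAt.inv₀ (f := fun x => ‖x - a i‖ ^ 2 + 0) (by fun_prop) (hr i)).smul
            (f := fun x => (‖x - a i‖ ^ 2 + 0)⁻¹) (g := fun x => x - a i) (by fun_prop)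
      have hq : ContinuousAt (fun x => 3 / 4 * ‖poleField a 0 x‖ ^ 2 / poleWeight a α 0 x) x₀ :=
        ((hW.norm.pow 2).const_mul _).div (continuous_poleWeight a hα 0).continuousAt
          (poleWeight_zero_pos a α hx₀).ne'
      set M := 3 / 4 * ‖poleField a 0 x₀‖ ^ 2 / poleWeight a α 0 x₀ + 1
      have hM0 : 0 ≤ M := by
        have := poleWeight_nonneg a α le_rfl x₀
        positivity
      refine ⟨_, mem_nhdsWithin_of_mem_nhds (hq.eventually_lt continuousAt_const
        (lt_add_one _)), M, hM0, fun x hx hxa => ?_⟩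
      have hx' : 3 / 4 * ‖poleField a 0 x‖ ^ 2 / poleWeight a α 0 x < M := hx
      rw [div_lt_iff₀ (poleWeight_zero_pos a α hxa)] at hx'
      have := potential_nonneg a x
      linarith
    · push Not at hx₀
      obtain ⟨k, rfl⟩ := hx₀
      -- With n ≥ 3 and δ = 1/10 the margin is 3/4 · 1.1 = 0.825 < 7/16 · (3 - 1.1) = 0.83125. Here
      -- M = 0 is forced in effect, since the weight may vanish at the pole.
      obtain ⟨R, hR, h⟩ := exists_norm_poleField_sq_le_near_pole ha k (δ := 1 / 10) (by norm_num)
      refine ⟨_, mem_nhdsWithin_of_mem_nhds (Metric.ball_mem_nhds (a k) hR), 0, le_rfl,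
        fun x hx hxa => ?_⟩
      have h1 := h x (hxa k) (by rwa [Metric.mem_ball, dist_eq_norm] at hx)
      have h2 := inv_norm_sub_sq_le_sum a k x
      have h3 : (3 : ℝ) ≤ n := by exact_mod_cast hn
      have h4 : 0 ≤ ∑ i, (‖x - a i‖ ^ 2)⁻¹ := Finset.sum_nonneg fun i _ => by positivity
      have h5 := mul_le_mul_of_nonneg_right h3 h4
      rw [potential_eq a hxa]
      linarith

/-- Eliminating S through V = nS - |W|² isolates the coefficient of |W|², which vanishes at α = β
and is negative beyond it. -/
theorem poleDensity_zero_eq_potential (hn : n ≠ 0) (a : Fin n → EuclideanSpace ℝ (Fin N))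
    (α t : ℝ) {x : EuclideanSpace ℝ (Fin N)} (hx : ∀ i, x ≠ a i) :
    poleDensity a N α t 0 x = α * (((N : ℝ) - 2) / n) * potential a x
      + α * (((N : ℝ) - 2) / n - α) * ‖poleField a 0 x‖ ^ 2
      + (t * N * poleWeight a α 0 x - t ^ 2 * (poleWeight a α 0 x ^ 2 * ‖x‖ ^ 2)) := by
  have hn' : (n : ℝ) ≠ 0 := Nat.cast_ne_zero.mpr hn
  rw [poleDensity_zero a _ α t hx, potential_eq a hx]
  field_simp
  ring

theorem integral_poleDensity_le (hN : 3 ≤ N) {Ω : Opens (EuclideanSpace ℝ (Fin N))}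
    (φ : 𝓓(Ω, ℝ)) (a : Fin n → EuclideanSpace ℝ (Fin N)) {α : ℝ} (hα : 0 ≤ α) (t : ℝ) :
    Integrable (fun x => φ x ^ 2 * poleDensity a N α t 0 x) ∧
    ∫ x, φ x ^ 2 * poleDensity a N α t 0 x ≤ ∫ x, ‖gradient φ x‖ ^ 2 := by
  have h := integral_sq_mul_poleDensity_zero_le (by simpa using hN)
    (φ.contDiff.of_le (by exact_mod_cast le_top)) φ.hasCompactSupport a hα t
  simpa only [finrank_euclideanSpace_fin] using h

theorem integrable_sq_mul_potential_and_le (hN : 3 ≤ N) (hn : n ≠ 0)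
    {Ω : Opens (EuclideanSpace ℝ (Fin N))} (φ : 𝓓(Ω, ℝ))
    (a : Fin n → EuclideanSpace ℝ (Fin N)) :
    Integrable (fun x => φ x ^ 2 * potential a x) ∧
    (((N : ℝ) - 2) ^ 2 / (n : ℝ) ^ 2) * ∫ x, φ x ^ 2 * potential a x
      ≤ ∫ x, ‖gradient φ x‖ ^ 2 := by
  have hn' : (0 : ℝ) < n := by positivity
  have hN' : (0 : ℝ) < (N : ℝ) - 2 := by
    have : (3 : ℝ) ≤ N := by exact_mod_cast hN
    linarith
  set β : ℝ := ((N : ℝ) - 2) / n with hβ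
  have hβ0 : 0 < β := by positivity
  obtain ⟨h1, h2⟩ := integral_poleDensity_le hN φ a hβ0.le 0
  have hae : (fun x => φ x ^ 2 * poleDensity a N β 0 0 x)
      =ᵐ[volume] fun x => β ^ 2 * (φ x ^ 2 * potential a x) := by
    filter_upwards [ae_forall_ne_pole (by simp; omega) a] with x hx
    rw [poleDensity_zero_eq_potential hn a β 0 hx, ← hβ]
    ring
  rw [integral_congr_ae hae, integral_const_mul] at h2
  refine ⟨(integrable_const_mul_iff (IsUnit.mk0 _ (by positivity)) _).mp (h1.congr hae), ?_⟩
  rwa [← div_pow, ← hβ]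

theorem le_hardyConstant (hN : 3 ≤ N) (hn : 2 ≤ n) (Ω : Opens (EuclideanSpace ℝ (Fin N)))
    {a : Fin n → EuclideanSpace ℝ (Fin N)} (ha : Function.Injective a) :
    ENNReal.ofReal (((N : ℝ) - 2) ^ 2 / (n : ℝ) ^ 2) ≤ hardyConstant Ω a := by
  refine ofReal_le_hardyConstant hN hn ha fun φ => ?_
  obtain ⟨h1, h2⟩ := integrable_sq_mul_potential_and_le hN (by omega) φ a
  exact ofReal_mul_lintegral_le_of_integral_le φ h1 h2

theorem lt_hardyConstant (hN : 3 ≤ N) (hn : 3 ≤ n) {Ω : Opens (EuclideanSpace ℝ (Fin N))}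
    (hΩ : Bornology.IsBounded (Ω : Set (EuclideanSpace ℝ (Fin N))))
    {a : Fin n → EuclideanSpace ℝ (Fin N)} (ha : Function.Injective a) :
    ENNReal.ofReal (((N : ℝ) - 2) ^ 2 / (n : ℝ) ^ 2) < hardyConstant Ω a := by
  have hn' : (0 : ℝ) < n := by positivity
  have hN3 : (3 : ℝ) ≤ N := by exact_mod_cast hN
  have hN' : (0 : ℝ) < (N : ℝ) - 2 := by linarith
  rw [← div_pow]
  set β : ℝ := ((N : ℝ) - 2) / n with hβ
  have hβ0 : 0 < β := by positivity
  have hK : IsCompact (closure (Ω : Set (EuclideanSpace ℝ (Fin N)))) := hΩ.isCompact_closure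
  obtain ⟨M, hM0, hM⟩ := exists_norm_poleField_sq_le_potential_add_poleWeight hn ha hβ0.le hK
  have hΦc := continuous_poleWeight a hβ0.le 0
  obtain ⟨B, hB⟩ := hK.exists_bound_of_continuousOn
    (f := fun x => poleWeight a β 0 x * ‖x‖ ^ 2) (by fun_prop)
  -- This t makes tΦ|x|² ≤ 1 on Ω, so t²Φ²|x|² ≤ tΦ and the weight terms sum to at least (N-1)tΦ ≥
  -- tΦ.
  set t : ℝ := (|B| + 1)⁻¹ with ht
  have ht0 : 0 < t := by positivity
  -- Multiplicity of the second inequality, chosen so that s·tΦ pays for the error β²MΦ of the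
  -- first.
  set s : ℝ := β ^ 2 * M / t with hs
  have hs0 : 0 ≤ s := by have : 0 ≤ M := hM0; positivity
  have hst : s * t = β ^ 2 * M := by rw [hs]; field_simp
  -- The first inequality leaves (3/2 - 7/16)β²V = (1 + 1/16)β²V, the second adds sβ²V; dividing by
  -- 1 + s gives this constant.
  have hc : β ^ 2 < β ^ 2 + β ^ 2 / (16 * (1 + s)) := by
    have : 0 < β ^ 2 / (16 * (1 + s)) := by positivity
    linarith
  refine ((ENNReal.ofReal_lt_ofReal_iff (by positivity)).mpr hc).trans_le
    (ofReal_le_hardyConstant hN (by omega) ha fun φ => ?_)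
  obtain ⟨hVint, -⟩ := integrable_sq_mul_potential_and_le hN (by omega) φ a
  refine ofReal_mul_lintegral_le_of_integral_le φ hVint ?_
  obtain ⟨h1, h1'⟩ := integral_poleDensity_le hN φ a (α := 3 / 2 * β) (by positivity) 0
  obtain ⟨h2, h2'⟩ := integral_poleDensity_le hN φ a hβ0.le t
  have hkey : (1 + s) * (β ^ 2 + β ^ 2 / (16 * (1 + s))) * ∫ x, φ x ^ 2 * potential a x
      ≤ ∫ x, (φ x ^ 2 * poleDensity a N (3 / 2 * β) 0 0 x
        + s * (φ x ^ 2 * poleDensity a N β t 0 x)) := by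
    rw [← integral_const_mul]
    refine integral_mono_ae (hVint.const_mul _) (h1.add (h2.const_mul s)) ?_
    filter_upwards [ae_forall_ne_pole (by simp; omega) a] with x hx
    by_cases hxΩ : x ∈ Ω
    swap
    · have : φ x = 0 := image_eq_zero_of_notMem_tsupport fun h => hxΩ (φ.tsupport_subset h)
      simp [this]
    have hxK := subset_closure hxΩ
    have hMx := hM x hxK hx
    have hBx := (le_abs_self _).trans ((hB x hxK).trans (le_abs_self B))
    have hΦ := poleWeight_nonneg a β le_rfl x
    have hgain : t * poleWeight a β 0 x
        ≤ t * N * poleWeight a β 0 x - t ^ 2 * (poleWeight a β 0 x ^ 2 * ‖x‖ ^ 2) := by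
      have h3 : t * (poleWeight a β 0 x * ‖x‖ ^ 2) ≤ 1 := by
        rw [ht, inv_mul_le_one₀ (by positivity)]
        linarith
      have h4 := mul_le_mul_of_nonneg_left h3 (mul_nonneg ht0.le hΦ)
      have h5 := mul_le_mul_of_nonneg_left hN3 (mul_nonneg ht0.le hΦ)
      nlinarith [mul_nonneg ht0.le hΦ]
    have hgain' := mul_le_mul_of_nonneg_left hgain hs0
    have hMβ := mul_le_mul_of_nonneg_left hMx (sq_nonneg β)
    have hcoef : (1 + s) * (β ^ 2 + β ^ 2 / (16 * (1 + s))) = (1 + s) * β ^ 2 + β ^ 2 / 16 := by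
      field_simp
    have hst' : s * (t * poleWeight a β 0 x) = β ^ 2 * M * poleWeight a β 0 x := by
      rw [← mul_assoc, hst]
    rw [poleDensity_zero_eq_potential (by omega) a _ 0 hx,
      poleDensity_zero_eq_potential (by omega) a _ t hx, ← hβ, hcoef]
    have hfin : ((1 + s) * β ^ 2 + β ^ 2 / 16) * potential a x
        ≤ (3 / 2 * β * β * potential a x
            + 3 / 2 * β * (β - 3 / 2 * β) * ‖poleField a 0 x‖ ^ 2)
          + s * (β * β * potential a x + (t * N * poleWeight a β 0 x
            - t ^ 2 * (poleWeight a β 0 x ^ 2 * ‖x‖ ^ 2))) := by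
      linarith
    have := mul_le_mul_of_nonneg_left hfin (sq_nonneg (φ x))
    linarith
  rw [integral_add h1 (h2.const_mul s), integral_const_mul] at hkey
  have h3 := mul_le_mul_of_nonneg_left h2' hs0
  have h4 : (1 + s) * ((β ^ 2 + β ^ 2 / (16 * (1 + s))) * ∫ x, φ x ^ 2 * potential a x)
      ≤ (1 + s) * ∫ x, ‖gradient φ x‖ ^ 2 := by linarith
  exact le_of_mul_le_mul_left h4 (by positivity)

end LowerBound

/-! ### Test functions and bubbles at the critical exponent -/

section UpperBound

variable {N n : ℕ}

theorem memD12_testFunction {Ω : Opens (EuclideanSpace ℝ (Fin N))} (φ : 𝓓(Ω, ℝ)) :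
    MemD12 Ω φ (gradient φ) where
  memLp := (φ.continuous.memLp_of_hasCompactSupport φ.hasCompactSupport).restrict _
  memLp_grad := ((continuous_gradient_testFunction φ).memLp_of_hasCompactSupport
    (hasCompactSupport_gradient_testFunction φ)).restrict _
  weakGradient := by
    intro ψ v
    have hDφ : Continuous (fderiv ℝ φ) := φ.contDiff.continuous_fderiv (by simp)
    have hDψ : Continuous (fderiv ℝ ψ) := ψ.contDiff.continuous_fderiv (by simp)
    have hinner : ∀ x, inner ℝ (gradient φ x) v = fderiv ℝ φ x v := fun x => by simp [gradient]
    have h0 : ∀ x, x ∉ (Ω : Set (EuclideanSpace ℝ (Fin N))) → φ x = 0 := fun x hx =>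
      image_eq_zero_of_notMem_tsupport fun h => hx (φ.tsupport_subset h)
    have h0' : ∀ x, x ∉ (Ω : Set (EuclideanSpace ℝ (Fin N))) → ψ x = 0 := fun x hx =>
      image_eq_zero_of_notMem_tsupport fun h => hx (ψ.tsupport_subset h)
    simp_rw [hinner]
    rw [setIntegral_eq_integral_of_forall_compl_eq_zero fun x hx => by simp [h0 x hx],
      setIntegral_eq_integral_of_forall_compl_eq_zero fun x hx => by simp [h0' x hx]]
    refine integral_mul_fderiv_eq_neg_fderiv_mul_of_integrable ?_ ?_ ?_ ?_ ?_
    · exact Continuous.integrable_of_hasCompactSupport (by fun_prop) ψ.hasCompactSupport.mul_left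
    · exact Continuous.integrable_of_hasCompactSupport (by fun_prop) φ.hasCompactSupport.mul_right
    · exact Continuous.integrable_of_hasCompactSupport (by fun_prop) ψ.hasCompactSupport.mul_left
    · exact fun x _ => φ.contDiff.differentiable (by simp) x
    · exact fun x _ => ψ.contDiff.differentiable (by simp) x
  approx := ⟨fun _ => φ, by simp, by simp⟩

theorem hardyConstant_le_testFunction {Ω : Opens (EuclideanSpace ℝ (Fin N))}
    (a : Fin n → EuclideanSpace ℝ (Fin N)) (φ : 𝓓(Ω, ℝ)) {x₀ : EuclideanSpace ℝ (Fin N)}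
    (hx₀ : x₀ ∈ Ω) (hφ : φ x₀ ≠ 0) :
    hardyConstant Ω a ≤ (∫⁻ x in Ω, ENNReal.ofReal (‖gradient φ x‖ ^ 2)) /
      (∫⁻ x in Ω, ENNReal.ofReal (potential a x * φ x ^ 2)) := by
  refine sInf_le ⟨φ, gradient φ, memD12_testFunction φ, fun h => hφ ?_, rfl⟩
  exact Measure.eqOn_open_of_ae_eq h Ω.isOpen φ.continuous.continuousOn continuousOn_const hx₀

/-- `|x|^{-N}` is not integrable at the origin of an `N`-dimensional space. -/
theorem lintegral_ball_inv_norm_pow_finrank {E : Type*} [NormedAddCommGroup E] [NormedSpace ℝ E]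
    [FiniteDimensional ℝ E] [Nontrivial E] [MeasurableSpace E] [BorelSpace E] (μ : Measure E)
    [μ.IsAddHaarMeasure] (b : E) {R : ℝ} (hR : 0 < R) :
    ∫⁻ x in Metric.ball b R, ENNReal.ofReal ((‖x - b‖ ^ Module.finrank ℝ E)⁻¹) ∂μ = ∞ := by
  have h0 : ¬ IntegrableOn (fun x : E => (‖x‖ ^ Module.finrank ℝ E)⁻¹) (Metric.ball 0 R) μ := by
    rw [integrableOn_fun_norm_addHaar μ (f := fun y : ℝ => (y ^ Module.finrank ℝ E)⁻¹)]
    intro h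
    have h1 : IntegrableOn (fun y : ℝ => y⁻¹) (Set.Ioo 0 R) := by
      refine h.congr_fun (fun y hy => ?_) measurableSet_Ioo
      have hy0 : y ≠ 0 := hy.1.ne'
      obtain ⟨k, hk⟩ := Nat.exists_eq_add_of_lt (Module.finrank_pos (R := ℝ) (M := E))
      simp only [hk, smul_eq_mul, zero_add, Nat.add_sub_cancel]
      field_simp
      exact (pow_succ y k).symm
    have h2 : IntervalIntegrable (fun y : ℝ => y⁻¹) volume 0 R := by
      rw [intervalIntegrable_iff_integrableOn_Ioo_of_le hR.le]
      exact h1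
    rcases intervalIntegrable_inv_iff.mp h2 with h3 | h3
    · exact hR.ne h3
    · exact h3 Set.left_mem_uIcc
  have h1 : ∫⁻ x in Metric.ball 0 R, ENNReal.ofReal ((‖x‖ ^ Module.finrank ℝ E)⁻¹) ∂μ = ∞ := by
    by_contra h
    refine h0 ⟨by fun_prop, ?_⟩
    rw [hasFiniteIntegral_iff_ofReal (Eventually.of_forall fun x => by positivity)]
    exact lt_top_iff_ne_top.mpr h
  rw [← h1, ← lintegral_indicator Metric.isOpen_ball.measurableSet,
    ← lintegral_indicator Metric.isOpen_ball.measurableSet,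
    ← lintegral_sub_right_eq_self ((Metric.ball (0 : E) R).indicator _) b]
  refine lintegral_congr fun x => ?_
  simp [Set.indicator, dist_eq_norm]

section Bubble

variable {E : Type*} [NormedAddCommGroup E]

/-- The regularized virtual ground state `(|x - b|² + ε) ^ (-p)`. -/
def bubble (b : E) (p ε : ℝ) (x : E) : ℝ := (‖x - b‖ ^ 2 + ε) ^ (-p)

theorem bubble_pos (b : E) (p : ℝ) {ε : ℝ} (hε : 0 < ε) (x : E) : 0 < bubble b p ε x := by
  unfold bubble
  positivity

theorem bubble_le (b : E) {p : ℝ} (hp : 0 ≤ p) {ε ρ : ℝ} (hε : 0 < ε) (hρ : 0 < ρ) {x : E}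
    (hx : ρ ≤ ‖x - b‖) : bubble b p ε x ≤ (ρ ^ 2) ^ (-p) := by
  refine Real.rpow_le_rpow_of_nonpos (by positivity) ?_ (by linarith)
  nlinarith

/-- The left side is the gradient energy density up to (2p)², the right side the Hardy density; both
quotient integrals can thus be measured by one quantity. It reduces to r/(r² + ε) ≤ 1/r. -/
theorem sq_norm_mul_bubble_sq_le (b : E) (p : ℝ) {ε : ℝ} (hε : 0 < ε) {x : E} (hx : x ≠ b) :
    (‖x - b‖ * bubble b (p + 1) ε x) ^ 2 ≤ (‖x - b‖ ^ 2)⁻¹ * bubble b p ε x ^ 2 := by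
  have hr : 0 < ‖x - b‖ := norm_pos_iff.mpr (sub_ne_zero.mpr hx)
  have h1 : bubble b (p + 1) ε x = bubble b p ε x / (‖x - b‖ ^ 2 + ε) := by
    rw [bubble, neg_add', Real.rpow_sub_one (by positivity), bubble]
  have h2 : ‖x - b‖ * bubble b (p + 1) ε x ≤ ‖x - b‖⁻¹ * bubble b p ε x := by
    have hb := bubble_pos b p hε x
    rw [h1, ← mul_div_assoc, div_le_iff₀ (by positivity)]
    have : ‖x - b‖⁻¹ * bubble b p ε x * (‖x - b‖ ^ 2 + ε)
        = ‖x - b‖ * bubble b p ε x + ‖x - b‖⁻¹ * bubble b p ε x * ε := by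
      field_simp
    rw [this]
    have : 0 ≤ ‖x - b‖⁻¹ * bubble b p ε x * ε := by positivity
    linarith
  have hb := bubble_pos b (p + 1) hε x
  calc _ ≤ (‖x - b‖⁻¹ * bubble b p ε x) ^ 2 := by gcongr
    _ = _ := by rw [mul_pow, inv_pow]

variable [InnerProductSpace ℝ E]

theorem contDiff_bubble (b : E) (p : ℝ) {ε : ℝ} (hε : 0 < ε) {m : WithTop ℕ∞} :
    ContDiff ℝ m (bubble b p ε) :=
  (contDiff_norm_sub_sq_add b ε).rpow_const_of_ne fun y => by positivity

theorem norm_fderiv_bubble (b : E) {p : ℝ} (hp : 0 ≤ p) {ε : ℝ} (hε : 0 < ε) (x : E) :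
    ‖fderiv ℝ (bubble b p ε) x‖ = 2 * p * (‖x - b‖ * bubble b (p + 1) ε x) := by
  have h : HasFDerivAt (bubble b p ε)
      ((-p * (‖x - b‖ ^ 2 + ε) ^ (-p - 1)) • (2 • innerSL ℝ (x - b))) x :=
    (hasFDerivAt_norm_sub_sq_add b ε x).rpow_const (Or.inl (by positivity))
  have hb := bubble_pos b (p + 1) hε x
  have hb' : (‖x - b‖ ^ 2 + ε) ^ (-p - 1) = bubble b (p + 1) ε x := by
    rw [bubble, neg_add']
  rw [h.fderiv, hb', norm_smul, ← Nat.cast_smul_eq_nsmul ℝ, norm_smul, innerSL_apply_norm,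
    norm_mul, norm_neg, Real.norm_of_nonneg hp, Real.norm_of_nonneg hb.le]
  norm_num
  ring

end Bubble

/-- The Dirichlet energy of the bubble blows up as `ε → 0`, at the critical exponent. -/
theorem tendsto_lintegral_bubble (hN : 3 ≤ N) (b : EuclideanSpace ℝ (Fin N)) {R : ℝ}
    (hR : 0 < R) :
    Tendsto (fun k : ℕ => ∫⁻ x in Metric.ball b R, ENNReal.ofReal
      ((‖x - b‖ * bubble b (((N : ℝ) - 2) / 4 + 1) (1 / ((k : ℝ) + 1)) x) ^ 2)) atTop (𝓝 ∞) := by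
  have : Nontrivial (EuclideanSpace ℝ (Fin N)) :=
    Module.nontrivial_of_finrank_pos (R := ℝ) (by simp; omega)
  have htop := lintegral_ball_inv_norm_pow_finrank (E := EuclideanSpace ℝ (Fin N)) volume b hR
  rw [finrank_euclideanSpace_fin] at htop
  set q : ℝ := ((N : ℝ) - 2) / 4 + 1 with hq
  have hlim : ∀ x, x ≠ b → Tendsto (fun k : ℕ => ENNReal.ofReal
      ((‖x - b‖ * bubble b q (1 / ((k : ℝ) + 1)) x) ^ 2)) atTop
      (𝓝 (ENNReal.ofReal ((‖x - b‖ ^ N)⁻¹))) := by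
    intro x hx
    have hr : 0 < ‖x - b‖ := norm_pos_iff.mpr (sub_ne_zero.mpr hx)
    have hc : ContinuousAt (fun ε : ℝ => (‖x - b‖ * (‖x - b‖ ^ 2 + ε) ^ (-q)) ^ 2) 0 := by
      have h0 : ContinuousAt (fun ε : ℝ => ‖x - b‖ ^ 2 + ε) 0 := by fun_prop
      exact ((h0.rpow_const (Or.inl (by positivity))).const_mul _).pow 2
    -- The exponent is 2 - 4q = -N, the borderline of non-integrability; Fatou then forces
    -- divergence.
    have hval : (‖x - b‖ * (‖x - b‖ ^ 2 + 0) ^ (-q)) ^ 2 = (‖x - b‖ ^ N)⁻¹ := by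
      rw [add_zero, ← Real.rpow_natCast ‖x - b‖ N, ← Real.rpow_neg hr.le,
        ← Real.rpow_natCast ‖x - b‖ 2, ← Real.rpow_mul hr.le, ← Real.rpow_one_add' hr.le,
        ← Real.rpow_natCast, ← Real.rpow_mul hr.le]
      · congr 1
        rw [hq]
        push_cast
        ring
      · have : (3 : ℝ) ≤ N := by exact_mod_cast hN
        rw [hq]
        push_cast
        intro h
        linarith
    have h1 := hc.tendsto.comp tendsto_one_div_add_atTop_nhds_zero_nat
    rw [hval] at h1
    exact ENNReal.tendsto_ofReal h1
  refine tendsto_of_le_liminf_of_limsup_le ?_ le_top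
  rw [← htop]
  refine le_trans (le_of_eq ?_) (lintegral_liminf_le fun k => ?_)
  · refine lintegral_congr_ae ?_
    filter_upwards [ae_restrict_of_ae (Measure.ae_ne volume b)] with x hx
    exact (hlim x hx).liminf_eq.symm
  · have := (contDiff_bubble b q (ε := 1 / ((k : ℝ) + 1)) (by positivity) (m := 0)).continuous
    exact Measurable.ennreal_ofReal (Continuous.measurable (by fun_prop))

end UpperBound

/-! ### Concentration at a pole and the upper bound -/

section Concentration

variable {N n : ℕ}

/-- The Dirichlet energy of a truncated bubble, up to an error that does not depend on `ε`. -/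
theorem exists_norm_gradient_mul_bubble_sq_le {b : EuclideanSpace ℝ (Fin N)} (χ : ContDiffBump b)
    {p : ℝ} (hp : 0 ≤ p) :
    ∃ C : ℝ, ∀ ε > 0, ∀ x,
      ENNReal.ofReal (‖gradient (fun y => χ y * bubble b p ε y) x‖ ^ 2)
        ≤ (Metric.ball b χ.rIn).indicator (fun x => ENNReal.ofReal ((2 * p) ^ 2)
            * ENNReal.ofReal ((‖x - b‖ * bubble b (p + 1) ε x) ^ 2)) x
          + (Metric.closedBall b χ.rOut).indicator (fun _ => ENNReal.ofReal C) x := by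
  have hχ : ContDiff ℝ 1 χ := χ.contDiff
  obtain ⟨L, hL⟩ := (hχ.continuous_fderiv one_ne_zero).bounded_above_of_compact_support
    (χ.hasCompactSupport.fderiv ℝ)
  have hL0 : 0 ≤ L := (norm_nonneg _).trans (hL b)
  have hrIn := χ.rIn_pos
  set D : ℝ := 2 * p * (χ.rOut * (χ.rIn ^ 2) ^ (-(p + 1))) + (χ.rIn ^ 2) ^ (-p) * L
  refine ⟨D ^ 2, fun ε hε x => ?_⟩
  have hgrad : ‖gradient (fun y => χ y * bubble b p ε y) x‖
      = ‖fderiv ℝ (fun y => χ y * bubble b p ε y) x‖ := by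
    simp [gradient]
  rw [hgrad]
  by_cases hin : x ∈ Metric.ball b χ.rIn
  · rw [Set.indicator_of_mem hin]
    have heq : (fun y => χ y * bubble b p ε y) =ᶠ[𝓝 x] bubble b p ε := by
      filter_upwards [Metric.isOpen_ball.mem_nhds hin] with y hy
      rw [χ.one_of_mem_closedBall (Metric.ball_subset_closedBall hy), one_mul]
    rw [heq.fderiv_eq, norm_fderiv_bubble b hp hε, mul_pow, ENNReal.ofReal_mul (by positivity)]
    exact le_self_add
  by_cases hout : x ∈ Metric.closedBall b χ.rOut
  · rw [Set.indicator_of_notMem hin, Set.indicator_of_mem hout, zero_add]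
    refine ENNReal.ofReal_le_ofReal (pow_le_pow_left₀ (norm_nonneg _) ?_ 2)
    have hx1 : χ.rIn ≤ ‖x - b‖ := by simpa [dist_eq_norm] using hin
    have hx2 : ‖x - b‖ ≤ χ.rOut := by simpa [dist_eq_norm] using hout
    have hd : HasFDerivAt (fun y => χ y * bubble b p ε y)
        (χ x • fderiv ℝ (bubble b p ε) x + bubble b p ε x • fderiv ℝ χ x) x :=
      (hχ.differentiable one_ne_zero x).hasFDerivAt.mul
        ((contDiff_bubble b p hε (m := 1)).differentiable one_ne_zero x).hasFDerivAt
    have hb := bubble_pos b p hε x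
    have hb1 := bubble_pos b (p + 1) hε x
    rw [hd.fderiv]
    refine (norm_add_le _ _).trans (add_le_add ?_ ?_)
    · rw [norm_smul, norm_fderiv_bubble b hp hε, Real.norm_of_nonneg χ.nonneg]
      calc χ x * (2 * p * (‖x - b‖ * bubble b (p + 1) ε x))
          ≤ 1 * (2 * p * (‖x - b‖ * bubble b (p + 1) ε x)) := by
            gcongr
            exact χ.le_one
        _ ≤ 2 * p * (χ.rOut * (χ.rIn ^ 2) ^ (-(p + 1))) := by
            rw [one_mul]
            gcongr
            · exact χ.rOut_pos.le
            · exact bubble_le b (by linarith) hε hrIn hx1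
    · rw [norm_smul, Real.norm_of_nonneg hb.le]
      gcongr
      · exact bubble_le b hp hε hrIn hx1
      · exact hL x
  · have hx : x ∉ tsupport (fun y => χ y * bubble b p ε y) := fun h =>
      hout (χ.tsupport_eq ▸ tsupport_mul_subset_left h)
    have h0 : fderiv ℝ (fun y => χ y * bubble b p ε y) x = 0 := by
      by_contra h
      exact hx (support_fderiv_subset ℝ h)
    simp [h0]

/-- The fixed cutoff error C is negligible against the diverging energy A k, leaving the ratio of
leading coefficients. -/
theorem ennreal_le_div_of_tendsto_top {h A₀ c C : ℝ≥0∞} (hc : c ≠ 0) (hc' : c ≠ ∞) (hC : C ≠ ∞)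
    {A : ℕ → ℝ≥0∞} (hA : Tendsto A atTop (𝓝 ∞)) (hA' : ∀ k, A k ≠ ∞)
    (hle : ∀ k, h ≤ (A₀ * A k + C) / (c * A k)) : h ≤ A₀ / c := by
  have hlim : Tendsto (fun k => A₀ / c + C / (c * A k)) atTop (𝓝 (A₀ / c)) := by
    have h1 : Tendsto (fun k => c * A k) atTop (𝓝 ∞) := by
      have := ENNReal.Tendsto.const_mul hA (Or.inr hc')
      rwa [ENNReal.mul_top hc] at this
    have h2 := ENNReal.Tendsto.const_div h1 (Or.inr hC)
    rw [ENNReal.div_top] at h2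
    simpa using h2.const_add (A₀ / c)
  refine ge_of_tendsto hlim ?_
  filter_upwards [hA.eventually_ne (b₂ := 0) ENNReal.top_ne_zero] with k hk
  refine (hle k).trans (le_of_eq ?_)
  rw [ENNReal.add_div, ENNReal.mul_div_mul_right _ _ hk (hA' k)]

theorem hardyConstant_le_of_near_pole (hN : 3 ≤ N) {Ω : Opens (EuclideanSpace ℝ (Fin N))}
    (a : Fin n → EuclideanSpace ℝ (Fin N)) {k : Fin n} (hk : a k ∈ Ω) {c R : ℝ} (hc : 0 < c)
    (hR : 0 < R)
    (hV : ∀ x, (∀ i, x ≠ a i) → ‖x - a k‖ < R → c * (‖x - a k‖ ^ 2)⁻¹ ≤ potential a x) :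
    hardyConstant Ω a ≤ ENNReal.ofReal (((N : ℝ) - 2) ^ 2 / 4 / c) := by
  obtain ⟨r, hr, hrΩ⟩ := Metric.isOpen_iff.mp Ω.isOpen (a k) hk
  set ρ := min R r
  have hρ : 0 < ρ := lt_min hR hr
  let χ : ContDiffBump (a k) := ⟨ρ / 4, ρ / 2, by positivity, by linarith⟩
  have hinΩ : Metric.ball (a k) (ρ / 4) ⊆ Ω := fun x hx => hrΩ
    (Metric.ball_subset_ball (by linarith [min_le_right R r]) hx)
  have houtΩ : Metric.closedBall (a k) (ρ / 2) ⊆ Ω := fun x hx => hrΩ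
    (Metric.closedBall_subset_ball (by linarith [min_le_right R r]) hx)
  have hN3 : (3 : ℝ) ≤ N := by exact_mod_cast hN
  -- The critical exponent: the energy diverges as ε → 0, and (2p)² = (N-2)²/4 is the numerator
  -- sought.
  set p : ℝ := ((N : ℝ) - 2) / 4 with hp
  have hp0 : 0 ≤ p := by rw [hp]; linarith
  obtain ⟨C, hC⟩ := exists_norm_gradient_mul_bubble_sq_le χ hp0
  let ε : ℕ → ℝ := fun m => 1 / ((m : ℝ) + 1)
  have hε : ∀ m, 0 < ε m := fun m => by positivity
  let u : ℕ → 𝓓(Ω, ℝ) := fun m =>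
    { toFun := fun y => χ y * bubble (a k) p (ε m) y
      contDiff' := χ.contDiff.mul (contDiff_bubble (a k) p (hε m))
      hasCompactSupport' := χ.hasCompactSupport.mul_right
      tsupport_subset' := fun x hx => houtΩ (χ.tsupport_eq ▸ tsupport_mul_subset_left hx) }
  have hu : ∀ m x, u m x = χ x * bubble (a k) p (ε m) x := fun m x => rfl
  let A : ℕ → ℝ≥0∞ := fun m => ∫⁻ x in Metric.ball (a k) (ρ / 4),
    ENNReal.ofReal ((‖x - a k‖ * bubble (a k) (p + 1) (ε m) x) ^ 2)
  have hcont : ∀ m, Continuous fun x => (‖x - a k‖ * bubble (a k) (p + 1) (ε m) x) ^ 2 :=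
    fun m => by
      have := (contDiff_bubble (a k) (p + 1) (hε m) (m := 0)).continuous
      fun_prop
  have hA : Tendsto A atTop (𝓝 ∞) := tendsto_lintegral_bubble hN (a k) (by positivity)
  have hA' : ∀ m, A m ≠ ∞ := by
    intro m
    have hint := ((hcont m).continuousOn.integrableOn_compact
      (isCompact_closedBall (a k) (ρ / 4))).mono_set Metric.ball_subset_closedBall (μ := volume)
    exact ((hasFiniteIntegral_iff_ofReal (Eventually.of_forall fun x => by positivity)).mp
      hint.2).ne
  have hnum : ∀ m, ∫⁻ x in Ω, ENNReal.ofReal (‖gradient (u m) x‖ ^ 2)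
      ≤ ENNReal.ofReal ((2 * p) ^ 2) * A m
        + ENNReal.ofReal C * volume (Metric.closedBall (a k) (ρ / 2)) := by
    intro m
    calc _ ≤ ∫⁻ x, ENNReal.ofReal (‖gradient (u m) x‖ ^ 2) := setLIntegral_le_lintegral _ _
      _ ≤ ∫⁻ x, ((Metric.ball (a k) (ρ / 4)).indicator (fun x => ENNReal.ofReal ((2 * p) ^ 2)
            * ENNReal.ofReal ((‖x - a k‖ * bubble (a k) (p + 1) (ε m) x) ^ 2)) x
          + (Metric.closedBall (a k) (ρ / 2)).indicator (fun _ => ENNReal.ofReal C) x) :=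
          lintegral_mono fun x => hC (ε m) (hε m) x
      _ = _ := by
          rw [lintegral_add_right _ (measurable_const.indicator Metric.isClosed_closedBall.measurableSet),
            lintegral_indicator Metric.isOpen_ball.measurableSet,
            lintegral_indicator_const Metric.isClosed_closedBall.measurableSet,
            lintegral_const_mul' _ _ ENNReal.ofReal_ne_top]
  have hden : ∀ m, ENNReal.ofReal c * A m
      ≤ ∫⁻ x in Ω, ENNReal.ofReal (potential a x * u m x ^ 2) := by
    intro m
    rw [← lintegral_const_mul' _ _ ENNReal.ofReal_ne_top]
    refine le_trans ?_ (lintegral_mono_set hinΩ)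
    refine setLIntegral_mono_ae' Metric.isOpen_ball.measurableSet ?_
    filter_upwards [ae_forall_ne_pole (by simp; omega) a] with x hx hxb
    rw [← ENNReal.ofReal_mul hc.le]
    refine ENNReal.ofReal_le_ofReal ?_
    rw [hu, χ.one_of_mem_closedBall (Metric.ball_subset_closedBall hxb), one_mul]
    have hxR : ‖x - a k‖ < R := by
      rw [Metric.mem_ball, dist_eq_norm] at hxb
      linarith [min_le_left R r]
    calc c * (‖x - a k‖ * bubble (a k) (p + 1) (ε m) x) ^ 2
        ≤ c * ((‖x - a k‖ ^ 2)⁻¹ * bubble (a k) p (ε m) x ^ 2) := by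
          gcongr
          exact sq_norm_mul_bubble_sq_le (a k) p (hε m) (hx k)
      _ = c * (‖x - a k‖ ^ 2)⁻¹ * bubble (a k) p (ε m) x ^ 2 := by ring
      _ ≤ potential a x * bubble (a k) p (ε m) x ^ 2 := by
          gcongr
          exact hV x hx hxR
  have hmain := ennreal_le_div_of_tendsto_top (h := hardyConstant Ω a)
    (A₀ := ENNReal.ofReal ((2 * p) ^ 2)) (c := ENNReal.ofReal c)
    (C := ENNReal.ofReal C * volume (Metric.closedBall (a k) (ρ / 2)))
    (ENNReal.ofReal_ne_zero_iff.mpr hc) ENNReal.ofReal_ne_top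
    (ENNReal.mul_ne_top ENNReal.ofReal_ne_top measure_closedBall_lt_top.ne) hA hA' fun m => by
      refine (hardyConstant_le_testFunction a (u m) hk ?_).trans
        (ENNReal.div_le_div (hnum m) (hden m))
      rw [hu, χ.one_of_mem_closedBall (Metric.mem_closedBall_self (by positivity)), one_mul]
      exact (bubble_pos _ _ (hε m) _).ne'
  rw [← ENNReal.ofReal_div_of_pos hc] at hmain
  convert hmain using 3
  rw [hp]
  ring

theorem hardyConstant_le (hN : 3 ≤ N) (hn : 2 ≤ n) {Ω : Opens (EuclideanSpace ℝ (Fin N))}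
    {a : Fin n → EuclideanSpace ℝ (Fin N)} (ha : Function.Injective a) (haΩ : ∀ i, a i ∈ Ω) :
    hardyConstant Ω a ≤ ENNReal.ofReal (((N : ℝ) - 2) ^ 2 / (4 * (n : ℝ) - 4)) := by
  have hn2 : (2 : ℝ) ≤ n := by exact_mod_cast hn
  let k : Fin n := ⟨0, by omega⟩
  -- Near a k one has V ≥ n r⁻² - (1 + δ)r⁻²; δ < 1 keeps n - 1 - δ positive when n ≥ 2, and δ → 0
  -- finishes.
  have hδ : ∀ δ : ℝ, 0 < δ → δ < 1 →
      hardyConstant Ω a ≤ ENNReal.ofReal (((N : ℝ) - 2) ^ 2 / 4 / ((n : ℝ) - 1 - δ)) := by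
    intro δ h0 h1
    obtain ⟨R, hR, h⟩ := exists_norm_poleField_sq_le_near_pole ha k h0
    refine hardyConstant_le_of_near_pole hN a (haΩ k) (by linarith) hR fun x hx hxR => ?_
    have h2 := h x (hx k) hxR
    have h3 := mul_le_mul_of_nonneg_left (inv_norm_sub_sq_le_sum a k x)
      (by linarith : (0 : ℝ) ≤ n)
    rw [potential_eq a hx]
    linarith
  have hlim : Tendsto (fun δ : ℝ => ENNReal.ofReal (((N : ℝ) - 2) ^ 2 / 4 / ((n : ℝ) - 1 - δ)))
      (𝓝[>] 0) (𝓝 (ENNReal.ofReal (((N : ℝ) - 2) ^ 2 / (4 * (n : ℝ) - 4)))) := by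
    have hc : ContinuousAt (fun δ : ℝ => ((N : ℝ) - 2) ^ 2 / 4 / ((n : ℝ) - 1 - δ)) 0 :=
      ContinuousAt.div (by fun_prop) (by fun_prop) (by simp; linarith)
    have heq : ((N : ℝ) - 2) ^ 2 / (4 * (n : ℝ) - 4)
        = ((N : ℝ) - 2) ^ 2 / 4 / ((n : ℝ) - 1 - 0) := by
      rw [div_div]
      congr 1
      ring
    rw [heq]
    exact ENNReal.tendsto_ofReal (hc.tendsto.mono_left nhdsWithin_le_nhds)
  refine ge_of_tendsto hlim ?_
  filter_upwards [Ioo_mem_nhdsGT one_pos] with δ hδ'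
  exact hδ δ hδ'.1 hδ'.2

end Concentration

end MultipolarHardy

end

theorem theorem1 (N n : ℕ) (hN : 3 ≤ N)
    (Ω : TopologicalSpace.Opens (EuclideanSpace ℝ (Fin N)))
    (a : Fin n → EuclideanSpace ℝ (Fin N)) (ha : Function.Injective a) (haΩ : ∀ i, a i ∈ Ω) :
    (n = 2 →
      MultipolarHardy.hardyConstant Ω a = ENNReal.ofReal (((N : ℝ) - 2) ^ 2 / 4)) ∧
    (3 ≤ n → Bornology.IsBounded (Ω : Set (EuclideanSpace ℝ (Fin N))) →
      ENNReal.ofReal (((N : ℝ) - 2) ^ 2 / (n : ℝ) ^ 2) < MultipolarHardy.hardyConstant Ω a ∧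
      MultipolarHardy.hardyConstant Ω a ≤
        ENNReal.ofReal (((N : ℝ) - 2) ^ 2 / (4 * (n : ℝ) - 4))) := by
  refine ⟨?_, fun hn hΩ => ⟨MultipolarHardy.lt_hardyConstant hN hn hΩ ha,
    MultipolarHardy.hardyConstant_le hN (by omega) ha haΩ⟩⟩
  rintro rfl
  -- At n = 2 both denominators equal 4: 4n - 4 = n².
  refine le_antisymm ?_ ?_
  · have h := MultipolarHardy.hardyConstant_le hN le_rfl ha haΩ
    norm_num at h
    exact h
  · have h := MultipolarHardy.le_hardyConstant hN le_rfl Ω ha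
    norm_num at h
    exact h
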